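/- Let $\mathbb D$ be the open unit disk, let $n\ge 1$, let $\tau,\sigma_1,\dots,\sigma_n\in\partial\mathbb D$ be pairwise distinct, put $F=\{\sigma_1,\dots,\sigma_n\}$, and let $\Lambda=(\lambda_1,\dots,\lambda_n)\in(-\infty,0)^n$. Write $\angle\lim$ for angular (non-tangential) limits. A one-parameter semigroup is a family $(\phi_t)_{t\ge0}$ of holomorphic self-maps of $\mathbb D$ with $\phi_0=\mathrm{id}$, $\phi_{s+t}=\phi_s\circ\phi_t$ and $\phi_t(z)\to z$ as $t\to0^+$ for each $z\in\mathbb D$; its infinitesimal generator is the holomorphic function $G:\mathbb D\to\mathbb C$ with $\frac{d}{dt}\phi_t(z)=G(\phi_t(z))$ for all $z\in\mathbb D$, $t\ge0$. A point $\sigma\in\partial\mathbb D$ is a boundary regular fixed point (BRFP) of $(\phi_t)$ if for every $t\ge0$ one has $\angle\lim_{z\to\sigma}\phi_t(z)=\sigma$ and the angular derivative $\angle\lim_{z\to\sigma}\frac{\phi_t(z)-\sigma}{z-\sigma}$ exists finitely; the spectral value at $\sigma$ is then $\angle\lim_{z\to\sigma}\frac{G(z)}{\sigma-z}$. Let $\mathsf{Gen}_\tau(F,\Lambda)$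 be the set of all infinitesimal generators $G$ of one-parameter semigroups which are trivial ($G\equiv0$) or have Denjoy–Wolff point $\tau$, and which have BRFPs $\sigma_1,\dots,\sigma_n$ with spectral values $\lambda_k'$ satisfying $\lambda_k\le\lambda'_k\le0$ for $k=1,\dots,n$. Put $$\alpha_k:=\frac{|\tau-\sigma_k|^2}{2|\lambda_k|},\qquad p_0(z):=\sum_{k=1}^n\alpha_k\frac{\sigma_k+z}{\sigma_k-z},\qquad Z:=\Big\{\zeta\in\mathbb C:\Big|\Big(2\tau^{-1}\sum_{k=1}^n\alpha_k\Big)\zeta-1\Big|\le1\Big\},$$ and $\ell_\zeta:=\frac{\tau}{\zeta}-\sum_{k=1}^n\alpha_k$ for $\zeta\in Z\setminus\{0\}$. **Theorem.** For every $G\in\mathsf{Gen}_\tau(F,\Lambda)$ with $G\not\equiv0$, the angular limit $$\beta(G):=\angle\lim_{z\to\tau}\frac{(\tau-z)^3}{\tau^2G(z)}$$ exists and is a finite real number, and the value region $$W_\tau(F,\Lambda):=\big\{(G(0),\beta(G))\in\mathbb C\times\mathbb R: G\in\mathsf{Gen}_\tau(F,\Lambda),\ G\not\equiv0\big\}$$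 coincides with the set $$\big\{(\zeta,b):\zeta\in Z\setminus\{0\},\ 0\le b\le2\,\mathrm{Re}\,\ell_\zeta\big\}.$$ Moreover, for each $\zeta\in Z\setminus\{0\}$ there exists a unique $G\in\mathsf{Gen}_\tau(F,\Lambda)$ such that $G(0)=\zeta$ and $\beta(G)=2\,\mathrm{Re}\,\ell_\zeta$; it is given by $$G(z)=G_{\zeta,\tau}(z):=\frac{(\tau-z)(1-\overline\tau z)}{\frac{\tau+z}{\tau-z}\,\mathrm{Re}\,\ell_\zeta+i\,\mathrm{Im}\,\ell_\zeta+p_0(z)},\qquad z\in\mathbb D.$$ -/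

import Mathlib

open Filter Topology Set

namespace DiskSemigroup

/-- The open unit disk `𝔻` of the complex plane. -/
def disk : Set ℂ := Metric.ball (0 : ℂ) 1

/-- The Stolz region of aperture `M` at the boundary point `σ`. -/
def stolzRegion (σ : ℂ) (M : ℝ) : Set ℂ := {z | ‖z‖ < 1 ∧ ‖σ - z‖ < M * (1 - ‖z‖)}

/-- `∠lim_{z → σ} f z = l`: inside every Stolz region at `σ`, `f z` tends to the finite
number `l` as `z → σ`. -/
def HasAngularLimit (f : ℂ → ℂ) (σ l : ℂ) : Prop :=
  ∀ M : ℝ, 1 < M → Tendsto f (𝓝[stolzRegion σ M] σ) (𝓝 l)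

/-- `f` has the (finite) angular derivative `d` at its boundary fixed point `σ`. -/
def HasAngularDerivAtFixed (f : ℂ → ℂ) (σ d : ℂ) : Prop :=
  HasAngularLimit (fun z => (f z - σ) / (z - σ)) σ d

/-- `σ ∈ ∂𝔻` is a boundary regular fixed point (BRFP) of the self-map `f` of the disk. -/
def IsBRFP (f : ℂ → ℂ) (σ : ℂ) : Prop :=
  ‖σ‖ = 1 ∧ HasAngularLimit f σ σ ∧ ∃ d : ℂ, HasAngularDerivAtFixed f σ d

/-- `τ` is the Denjoy-Wolff point of the holomorphic self-map `f ≠ id` of the disk: either `τ`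
is a fixed point in the disk, with multiplier of modulus at most one, or `f` has no fixed
point in the disk and `τ` is a BRFP of `f` with angular derivative at most one. -/
def IsDWPointOfMap (f : ℂ → ℂ) (τ : ℂ) : Prop :=
  (τ ∈ disk ∧ f τ = τ ∧ ‖deriv f τ‖ ≤ 1) ∨
  ((∀ z ∈ disk, f z ≠ z) ∧ IsBRFP f τ ∧
    ∃ d : ℝ, HasAngularDerivAtFixed f τ (d : ℂ) ∧ d ≤ 1)

/-- `(φ t)`, `t ≥ 0`, is a one-parameter semigroup of holomorphic self-maps of the disk. Only
the values `φ t z` with `t ≥ 0` and `z ∈ 𝔻` matter. -/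
structure IsSemigroup (φ : ℝ → ℂ → ℂ) : Prop where
  holo : ∀ t : ℝ, 0 ≤ t → DifferentiableOn ℂ (φ t) disk
  mapsTo : ∀ t : ℝ, 0 ≤ t → MapsTo (φ t) disk disk
  zero : ∀ z ∈ disk, φ 0 z = z
  add : ∀ s t : ℝ, 0 ≤ s → 0 ≤ t → ∀ z ∈ disk, φ (s + t) z = φ s (φ t z)
  cont : ∀ z ∈ disk, Tendsto (fun t => φ t z) (𝓝[>] 0) (𝓝 z)

/-- `G` is the infinitesimal generator of `(φ t)`: it is holomorphic in the disk and
`d/dt φ_t(z) = G (φ_t(z))` for all `z ∈ 𝔻` and `t ≥ 0` (one-sided derivative at `t = 0`). -/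
def IsGenerator (φ : ℝ → ℂ → ℂ) (G : ℂ → ℂ) : Prop :=
  DifferentiableOn ℂ G disk ∧
  ∀ z ∈ disk, ∀ t : ℝ, 0 ≤ t → HasDerivWithinAt (fun s => φ s z) (G (φ t z)) (Ici 0) t

/-- The semigroup consists of the identity map only. -/
def IsTrivial (φ : ℝ → ℂ → ℂ) : Prop := ∀ t : ℝ, 0 < t → EqOn (φ t) id disk

/-- `τ` is the Denjoy-Wolff point of the non-trivial semigroup `(φ t)`: it is the Denjoy-Wolff
point of every element different from the identity. -/
def IsDWPoint (φ : ℝ → ℂ → ℂ) (τ : ℂ) : Prop :=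
  ¬ IsTrivial φ ∧ ∀ t : ℝ, 0 < t → ¬ EqOn (φ t) id disk → IsDWPointOfMap (φ t) τ

/-- `σ` is a BRFP of the semigroup `(φ t)`. -/
def IsSemigroupBRFP (φ : ℝ → ℂ → ℂ) (σ : ℂ) : Prop := ∀ t : ℝ, 0 ≤ t → IsBRFP (φ t) σ

/-- `l` is the spectral value at the BRFP `σ` of the semigroup generated by `G`. -/
def HasSpectralValue (G : ℂ → ℂ) (σ : ℂ) (l : ℝ) : Prop :=
  HasAngularLimit (fun z => G z / (σ - z)) σ (l : ℂ)

/-- The class `Gen_τ(F, Λ)`, where `F = {σ 1, …, σ n}` and `Λ = (lam 1, …, lam n)`: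
infinitesimal generators of semigroups that are trivial or have the Denjoy-Wolff point `τ`, and
that have BRFPs `σ k` with spectral values in `[lam k, 0]`. Functions on `𝔻` are
represented by functions on `ℂ` whose values outside `𝔻` are irrelevant. -/
def Gen {n : ℕ} (τ : ℂ) (σ : Fin n → ℂ) (lam : Fin n → ℝ) : Set (ℂ → ℂ) :=
  {G | ∃ φ : ℝ → ℂ → ℂ, IsSemigroup φ ∧ IsGenerator φ G ∧
    (IsTrivial φ ∨ IsDWPoint φ τ) ∧
    ∀ k, IsSemigroupBRFP φ (σ k) ∧
      ∃ l : ℝ, HasSpectralValue G (σ k) l ∧ lam k ≤ l ∧ l ≤ 0}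

/-- `β(G) = b`, i.e. `b` is the angular limit of `(τ - z)³ / (τ² G(z))` at `τ`. -/
def HasBeta (τ : ℂ) (G : ℂ → ℂ) (b : ℝ) : Prop :=
  HasAngularLimit (fun z => (τ - z) ^ 3 / (τ ^ 2 * G z)) τ (b : ℂ)

/-- The value region `W_τ(F, Λ)` of `(G(0), β(G))` over all `G ∈ Gen_τ(F, Λ)`, `G ≢ 0`. -/
def valueRegion {n : ℕ} (τ : ℂ) (σ : Fin n → ℂ) (lam : Fin n → ℝ) : Set (ℂ × ℝ) :=
  {p | ∃ G ∈ Gen τ σ lam, ¬ EqOn G 0 disk ∧ G 0 = p.1 ∧ HasBeta τ G p.2}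

noncomputable section

/-- `α_k = |τ - σ_k|² / (2 |λ_k|)`. -/
def alpha {n : ℕ} (τ : ℂ) (σ : Fin n → ℂ) (lam : Fin n → ℝ) (k : Fin n) : ℝ :=
  ‖τ - σ k‖ ^ 2 / (2 * |lam k|)

/-- `p₀(z; F, Λ) = ∑ α_k (σ_k + z) / (σ_k - z)`. -/
def pZero {n : ℕ} (τ : ℂ) (σ : Fin n → ℂ) (lam : Fin n → ℝ) (z : ℂ) : ℂ :=
  ∑ k, (alpha τ σ lam k : ℂ) * ((σ k + z) / (σ k - z))

/-- The closed disk `Z = {ζ : |(2 τ⁻¹ ∑ α_k) ζ - 1| ≤ 1}`. -/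
def diskZ {n : ℕ} (τ : ℂ) (σ : Fin n → ℂ) (lam : Fin n → ℝ) : Set ℂ :=
  {ζ | ‖(2 * τ⁻¹ * ∑ k, (alpha τ σ lam k : ℂ)) * ζ - 1‖ ≤ 1}

/-- `ℓ_ζ = τ / ζ - ∑ α_k`. -/
def ell {n : ℕ} (τ : ℂ) (σ : Fin n → ℂ) (lam : Fin n → ℝ) (ζ : ℂ) : ℂ :=
  τ / ζ - ∑ k, (alpha τ σ lam k : ℂ)

/-- The extremal function `G_{ζ,τ}`. -/
def extremalG {n : ℕ} (τ : ℂ) (σ : Fin n → ℂ) (lam : Fin n → ℝ) (ζ z : ℂ) : ℂ :=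
  (τ - z) * (1 - (starRingEnd ℂ) τ * z) /
    ((τ + z) / (τ - z) * ((ell τ σ lam ζ).re : ℂ) + Complex.I * ((ell τ σ lam ζ).im : ℂ)
      + pZero τ σ lam z)

end

end DiskSemigroup

open DiskSemigroup

/-!
By the Berkson–Porta formula, the non-trivial generators `G` with Denjoy–Wolff point `τ` are the
quotients `(τ - z) ^ 2 / (τ * h z)` with `h` holomorphic of non-negative real part. For such an `h`
and `‖σ‖ = 1`, the largest `m` with `m * Re ((σ + z) / (σ - z)) ≤ Re (h z)` is also the angular
limit of `(σ - z) * h z / (2 * σ)`: it is the mass of the Herglotz measure of `h` at `σ`. The point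
`σ k` is a boundary regular fixed point with spectral value `l` exactly when the mass `m` there is
positive, and then `2 * m * l = -‖τ - σ k‖ ^ 2`. Thus `lam k ≤ l` says that the mass at `σ k` is at
least `alpha τ σ lam k`, and `Gen τ σ lam` is parametrized by `h = pZero τ σ lam + q` with an
arbitrary Herglotz function `q`. In this parametrization `q 0 = ell τ σ lam (G 0)`, while `β(G)` is
twice the mass of `q` at `τ`. That mass lies between `0` and `Re (q 0)`, and equals `Re (q 0)` only
if `q` is `Re (q 0) * (τ + z) / (τ - z)` plus an imaginary constant.

To integrate `G`, pass to the half-plane with `τ` at infinity, where the field `f` has positive real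
part. A primitive `H` of `1 / f` is injective by Noshiro–Warschawski and turns the flow into a
translation. A trajectory cannot reach the boundary in finite time: its real part increases, while
its hyperbolic speed does not.
-/

namespace DiskSemigroup

open scoped ComplexConjugate

/-! ### The Cayley transform -/

/-- The open right half-plane, the model of the disk in which a boundary point sits at infinity. -/
def rightHalfPlane : Set ℂ := {w | 0 < w.re}

/-- The Cayley transform of the disk onto the right half-plane with pole `σ`; for `‖σ‖ = 1` its
real part is the Poisson kernel at `σ`. -/
noncomputable def cayley (σ z : ℂ) : ℂ := (σ + z) / (σ - z)

/-- The inverse of the Cayley transform with pole `σ`. -/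
noncomputable def cayleyInv (σ w : ℂ) : ℂ := σ * (w - 1) / (w + 1)

theorem mem_disk {z : ℂ} : z ∈ disk ↔ ‖z‖ < 1 := by simp [disk]

theorem zero_mem_disk : (0 : ℂ) ∈ disk := mem_disk.mpr (by simp)

theorem isOpen_disk : IsOpen disk := Metric.isOpen_ball

theorem mem_rightHalfPlane {w : ℂ} : w ∈ rightHalfPlane ↔ 0 < w.re := Iff.rfl

theorem isOpen_rightHalfPlane : IsOpen rightHalfPlane :=
  isOpen_lt continuous_const Complex.continuous_re

theorem convex_rightHalfPlane : Convex ℝ rightHalfPlane := convex_halfSpace_re_gt 0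

theorem one_mem_rightHalfPlane : (1 : ℂ) ∈ rightHalfPlane := by simp [rightHalfPlane]

theorem add_one_ne_zero {w : ℂ} (hw : w ∈ rightHalfPlane) : w + 1 ≠ 0 := by
  intro h
  have := congrArg Complex.re h
  simp only [Complex.add_re, Complex.one_re, Complex.zero_re] at this
  linarith [mem_rightHalfPlane.mp hw]

theorem ne_zero_of_norm_eq_one {σ : ℂ} (hσ : ‖σ‖ = 1) : σ ≠ 0 :=
  norm_ne_zero_iff.mp (hσ ▸ one_ne_zero)

theorem re_inv_nonneg {w : ℂ} (h : 0 ≤ w.re) : 0 ≤ (w⁻¹).re := by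
  rw [Complex.inv_re]
  exact div_nonneg h (Complex.normSq_nonneg w)

theorem re_inv_pos {w : ℂ} (h : 0 < w.re) : 0 < (w⁻¹).re := by
  rw [Complex.inv_re]
  exact div_pos h (Complex.normSq_pos.mpr fun h0 => by simp [h0] at h)

theorem sub_ne_zero_of_mem_disk {σ z : ℂ} (hσ : ‖σ‖ = 1) (hz : z ∈ disk) : σ - z ≠ 0 := by
  refine sub_ne_zero.mpr fun h => ?_
  exact (h ▸ mem_disk.mp hz : ‖σ‖ < 1).ne hσ

theorem cayley_zero {σ : ℂ} (hσ : ‖σ‖ = 1) : cayley σ 0 = 1 := by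
  simp [cayley, ne_zero_of_norm_eq_one hσ]

theorem cayley_add_one {σ z : ℂ} (h : σ - z ≠ 0) : cayley σ z + 1 = 2 * σ / (σ - z) := by
  rw [cayley]
  field_simp
  ring

theorem re_cayley {σ : ℂ} (hσ : ‖σ‖ = 1) (z : ℂ) :
    (cayley σ z).re = (1 - ‖z‖ ^ 2) / ‖σ - z‖ ^ 2 := by
  have h : σ.re * σ.re + σ.im * σ.im = 1 := by
    rw [← Complex.normSq_apply, ← Complex.sq_norm, hσ, one_pow]
  rw [cayley, Complex.div_re, ← add_div, Complex.sq_norm, Complex.sq_norm]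
  congr 1
  simp only [Complex.normSq_apply, Complex.sub_re, Complex.sub_im, Complex.add_re, Complex.add_im]
  linear_combination h

theorem re_cayley_pos {σ z : ℂ} (hσ : ‖σ‖ = 1) (hz : z ∈ disk) : 0 < (cayley σ z).re := by
  rw [re_cayley hσ]
  have := mem_disk.mp hz
  have h1 := norm_pos_iff.mpr (sub_ne_zero_of_mem_disk hσ hz)
  apply div_pos _ (by positivity)
  nlinarith [norm_nonneg z]

theorem mapsTo_cayley {σ : ℂ} (hσ : ‖σ‖ = 1) : MapsTo (cayley σ) disk rightHalfPlane :=
  fun _ hz => re_cayley_pos hσ hz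

theorem hasDerivAt_cayley {σ z : ℂ} (h : σ - z ≠ 0) :
    HasDerivAt (cayley σ) (2 * σ / (σ - z) ^ 2) z := by
  refine (((hasDerivAt_id' z).const_add σ).div ((hasDerivAt_id' z).const_sub σ) h).congr_deriv ?_
  ring

theorem differentiableOn_cayley {σ : ℂ} (hσ : ‖σ‖ = 1) : DifferentiableOn ℂ (cayley σ) disk :=
  fun _ hz => (hasDerivAt_cayley
    (sub_ne_zero_of_mem_disk hσ hz)).differentiableAt.differentiableWithinAt

theorem mapsTo_cayleyInv {σ : ℂ} (hσ : ‖σ‖ = 1) :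
    MapsTo (cayleyInv σ) rightHalfPlane disk := by
  intro w hw
  rw [mem_disk, cayleyInv, norm_div, norm_mul, hσ, one_mul,
    div_lt_one (norm_pos_iff.mpr (add_one_ne_zero hw))]
  refine lt_of_pow_lt_pow_left₀ 2 (norm_nonneg _) ?_
  simp only [Complex.sq_norm, Complex.normSq_apply, Complex.sub_re, Complex.sub_im, Complex.add_re,
    Complex.add_im, Complex.one_re, Complex.one_im]
  nlinarith [mem_rightHalfPlane.mp hw]

theorem sub_cayleyInv {σ w : ℂ} (hw : w + 1 ≠ 0) : σ - cayleyInv σ w = 2 * σ / (w + 1) := by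
  rw [cayleyInv]
  field_simp
  ring

theorem cayley_cayleyInv {σ w : ℂ} (hσ : σ ≠ 0) (hw : w + 1 ≠ 0) :
    cayley σ (cayleyInv σ w) = w := by
  have h1 : σ + cayleyInv σ w = 2 * σ * w / (w + 1) := by rw [cayleyInv]; field_simp; ring
  rw [cayley, h1, sub_cayleyInv hw]
  field_simp

theorem leftInvOn_cayleyInv {σ : ℂ} (hσ : ‖σ‖ = 1) :
    LeftInvOn (cayleyInv σ) (cayley σ) disk := by
  intro z hz
  have hσ0 := ne_zero_of_norm_eq_one hσ
  have hz := sub_ne_zero_of_mem_disk hσ hz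
  have h1 : cayley σ z - 1 = 2 * z / (σ - z) := by rw [cayley]; field_simp; ring
  rw [cayleyInv, h1, cayley_add_one hz]
  field_simp

theorem hasDerivAt_cayleyInv {σ w : ℂ} (hσ : σ ≠ 0) (hw : w + 1 ≠ 0) :
    HasDerivAt (cayleyInv σ) ((σ - cayleyInv σ w) ^ 2 / (2 * σ)) w := by
  refine ((((hasDerivAt_id' w).sub_const 1).const_mul σ).div
    ((hasDerivAt_id' w).add_const 1) hw).congr_deriv ?_
  rw [sub_cayleyInv hw]
  field_simp
  ring

theorem differentiableOn_cayleyInv {σ : ℂ} (hσ : ‖σ‖ = 1) :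
    DifferentiableOn ℂ (cayleyInv σ) rightHalfPlane := fun _ hw =>
  (hasDerivAt_cayleyInv (ne_zero_of_norm_eq_one hσ)
    (add_one_ne_zero hw)).differentiableAt.differentiableWithinAt

/-! ### Holomorphic functions with non-negative real part on the half-plane -/

/-- The sector of aperture `M` in the right half-plane, the image under a Cayley transform of an
approach region at its pole. -/
def sector (M : ℝ) : Set ℂ := {w | 0 < w.re ∧ ‖w‖ ≤ M * w.re}

theorem norm_add_conj_sq_sub_norm_sub_sq (a w : ℂ) :
    ‖w + conj a‖ ^ 2 - ‖w - a‖ ^ 2 = 4 * (w.re * a.re) := by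
  simp only [Complex.sq_norm, Complex.normSq_apply, Complex.add_re, Complex.add_im,
    Complex.sub_re, Complex.sub_im, Complex.conj_re, Complex.conj_im]
  ring

theorem norm_sub_zero_mul_le_of_re_nonneg {g : ℂ → ℂ} (hg : DifferentiableOn ℂ g disk)
    (hre : ∀ z ∈ disk, 0 ≤ (g z).re) {z : ℂ} (hz : z ∈ disk) :
    ‖g z - g 0‖ * (1 - ‖z‖) ≤ 2 * (g 0).re * ‖z‖ := by
  have hbound : ∀ ε > 0, ‖g z - g 0‖ * (1 - ‖z‖) ≤ 2 * ((g 0).re + ε) * ‖z‖ := by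
    intro ε hε
    have hbc := Complex.borelCaratheodory_zero (M := (g 0).re + ε)
      (by linarith [hre 0 zero_mem_disk]) (hg.const_sub (g 0))
      (fun v hv => by
        have := hre v hv
        simp only [mem_ofPred_eq, Complex.sub_re]; linarith) one_pos hz (sub_self _)
    rwa [norm_sub_rev, le_div_iff₀ (by linarith [mem_disk.mp hz])] at hbc
  have hlim : Tendsto (fun ε : ℝ => 2 * ((g 0).re + ε) * ‖z‖) (𝓝[>] 0)
      (𝓝 (2 * ((g 0).re + 0) * ‖z‖)) :=
    (Continuous.tendsto (by fun_prop) 0).mono_left nhdsWithin_le_nhds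
  rw [add_zero] at hlim
  exact ge_of_tendsto hlim (eventually_mem_nhdsWithin.mono hbound)

theorem exists_mem_disk_re_mul_cayley_add_im_eq {a w : ℂ} (ha : a ∈ rightHalfPlane)
    (hw : w ∈ rightHalfPlane) :
    ∃ z ∈ disk, a.re * cayley 1 z + a.im * Complex.I = w ∧ ‖z‖ = ‖w - a‖ / ‖w + conj a‖ := by
  have ha0 : (a.re : ℂ) ≠ 0 := Complex.ofReal_ne_zero.mpr (mem_rightHalfPlane.mp ha).ne'
  set u : ℂ := (w - a.im * Complex.I) / a.re with hu_def
  have hu : u ∈ rightHalfPlane := by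
    simpa [u, rightHalfPlane, Complex.div_ofReal_re] using div_pos hw ha
  refine ⟨cayleyInv 1 u, mapsTo_cayleyInv norm_one hu, ?_, ?_⟩
  · rw [cayley_cayleyInv one_ne_zero (add_one_ne_zero hu), hu_def]
    field_simp
    ring
  · have h1 : u - 1 = (w - a) / a.re := by
      rw [hu_def]; field_simp; linear_combination -Complex.re_add_im a
    have h2 : u + 1 = (w + conj a) / a.re := by
      rw [hu_def]; field_simp
      linear_combination 2 * Complex.re_eq_add_conj a - Complex.re_add_im a
    rw [cayleyInv, h1, h2, one_mul, div_div_div_cancel_right₀ ha0, norm_div]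

section HalfPlane

variable {f : ℂ → ℂ} (hf : DifferentiableOn ℂ f rightHalfPlane)
  (hre : ∀ w ∈ rightHalfPlane, 0 ≤ (f w).re)

include hf hre

theorem norm_sub_mul_le_of_re_nonneg {a w : ℂ} (ha : a ∈ rightHalfPlane)
    (hw : w ∈ rightHalfPlane) :
    ‖f w - f a‖ * (‖w + conj a‖ - ‖w - a‖) ≤ 2 * (f a).re * ‖w - a‖ := by
  set ψ : ℂ → ℂ := fun z => a.re * cayley 1 z + a.im * Complex.I
  have hψ : MapsTo ψ disk rightHalfPlane := fun z hz => by
    simpa [ψ, rightHalfPlane] using mul_pos ha (re_cayley_pos norm_one hz)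
  have hψ0 : ψ 0 = a := by simp [ψ, cayley_zero norm_one, Complex.re_add_im]
  obtain ⟨z, hz, hψz : ψ z = w, hnorm⟩ := exists_mem_disk_re_mul_cayley_add_im_eq ha hw
  have hsum : 0 < ‖w + conj a‖ := norm_pos_iff.mpr fun h => by
    have := congrArg Complex.re h
    simp only [Complex.add_re, Complex.conj_re, Complex.zero_re] at this
    linarith [mem_rightHalfPlane.mp ha, mem_rightHalfPlane.mp hw]
  have h := norm_sub_zero_mul_le_of_re_nonneg
    (hf.comp (((differentiableOn_cayley norm_one).const_mul _).add_const _) hψ)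
    (fun v hv => hre _ (hψ hv)) hz
  change ‖f (ψ z) - f (ψ 0)‖ * (1 - ‖z‖) ≤ 2 * (f (ψ 0)).re * ‖z‖ at h
  rw [hψz, hψ0, hnorm, one_sub_div hsum.ne', mul_div_assoc', mul_div_assoc',
    div_le_div_iff_of_pos_right hsum] at h
  exact h

theorem norm_sub_mul_re_mul_re_le {a w : ℂ} (ha : a ∈ rightHalfPlane) (hw : w ∈ rightHalfPlane) :
    ‖f w - f a‖ * (w.re * a.re) ≤ (f a).re * ‖w + conj a‖ ^ 2 := by
  have hharnack := norm_sub_mul_le_of_re_nonneg hf hre ha hw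
  have hid := norm_add_conj_sq_sub_norm_sub_sq a w
  have hpos : 0 < w.re * a.re := mul_pos hw ha
  have hle : ‖w - a‖ ≤ ‖w + conj a‖ :=
    le_of_sq_le_sq (by linarith) (norm_nonneg _)
  calc ‖f w - f a‖ * (w.re * a.re)
      = ‖f w - f a‖ * (‖w + conj a‖ - ‖w - a‖) * (‖w + conj a‖ + ‖w - a‖) / 4 := by
        linear_combination (-‖f w - f a‖ / 4) * hid
    _ ≤ 2 * (f a).re * ‖w - a‖ * (‖w + conj a‖ + ‖w - a‖) / 4 := by gcongr
    _ ≤ 2 * (f a).re * ‖w + conj a‖ * (‖w + conj a‖ + ‖w + conj a‖) / 4 := by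
        have := hre a ha
        gcongr
    _ = (f a).re * ‖w + conj a‖ ^ 2 := by ring

theorem eq_of_re_eq_zero {a w : ℂ} (ha : a ∈ rightHalfPlane) (hw : w ∈ rightHalfPlane)
    (h0 : (f a).re = 0) : f w = f a := by
  have h := norm_sub_mul_re_mul_re_le hf hre ha hw
  rw [h0, zero_mul] at h
  have hpos : 0 < w.re * a.re := mul_pos hw ha
  have : ‖f w - f a‖ ≤ 0 := nonpos_of_mul_nonpos_left h hpos
  exact sub_eq_zero.mp (norm_le_zero_iff.mp this)

theorem norm_deriv_mul_re_le {a f' : ℂ} (ha : a ∈ rightHalfPlane) (hf' : HasDerivAt f f' a) :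
    ‖f'‖ * a.re ≤ (f a).re := by
  have hslope : Tendsto (fun w => ‖slope f a w‖ * (‖w + conj a‖ - ‖w - a‖)) (𝓝[≠] a)
      (𝓝 (‖f'‖ * (‖a + conj a‖ - ‖a - a‖))) :=
    (hasDerivAt_iff_tendsto_slope.mp hf').norm.mul
      ((Continuous.tendsto (by fun_prop) a).mono_left nhdsWithin_le_nhds)
  have hbound : ∀ᶠ w in 𝓝[≠] a, ‖slope f a w‖ * (‖w + conj a‖ - ‖w - a‖) ≤ 2 * (f a).re := by
    filter_upwards [self_mem_nhdsWithin,
      nhdsWithin_le_nhds (isOpen_rightHalfPlane.mem_nhds ha)] with w hwa hw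
    have hpos : 0 < ‖w - a‖ := norm_pos_iff.mpr (sub_ne_zero.mpr hwa)
    have h := norm_sub_mul_le_of_re_nonneg hf hre ha hw
    rw [slope_def_field, norm_div, div_mul_eq_mul_div, div_le_iff₀ hpos]
    exact h
  have h := le_of_tendsto hslope hbound
  have hnorm : ‖a + conj a‖ = 2 * a.re := by
    rw [Complex.add_conj, Complex.norm_real, Real.norm_of_nonneg]
    linarith [mem_rightHalfPlane.mp ha]
  rw [sub_self, norm_zero, sub_zero, hnorm] at h
  linarith

theorem tendsto_div_zero_of_small (hsmall : ∀ ε > 0, ∃ a ∈ rightHalfPlane, (f a).re ≤ ε * a.re)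
    {M : ℝ} (hM : 0 < M) :
    Tendsto (fun w => f w / w) (Bornology.cobounded ℂ ⊓ 𝓟 (sector M)) (𝓝 0) := by
  rw [Metric.tendsto_nhds]
  intro δ hδ
  obtain ⟨a, ha, hfa⟩ := hsmall (δ / (8 * M)) (by positivity)
  have hlarge := (tendsto_norm_cobounded_atTop (E := ℂ)).eventually_gt_atTop
    (max (max ‖a‖ 0) (2 * ‖f a‖ / δ))
  filter_upwards [mem_inf_of_left hlarge, mem_inf_of_right (mem_principal_self _)] with w hw hwM
  obtain ⟨⟨hwa, hw0⟩, hwf⟩ : (‖a‖ < ‖w‖ ∧ 0 < ‖w‖) ∧ 2 * ‖f a‖ / δ < ‖w‖ := by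
    simpa only [max_lt_iff] using hw
  obtain ⟨hwre, hwM⟩ := hwM
  have hare : 0 < a.re := ha
  have hadd : ‖w + conj a‖ ≤ 2 * ‖w‖ :=
    (norm_add_le _ _).trans (by rw [RCLike.norm_conj]; linarith)
  have hdiff : ‖f w - f a‖ * w.re ≤ δ / 2 * ‖w‖ * w.re := by
    refine le_of_mul_le_mul_right ?_ hare
    calc ‖f w - f a‖ * w.re * a.re
        = ‖f w - f a‖ * (w.re * a.re) := mul_assoc _ _ _
      _ ≤ (f a).re * ‖w + conj a‖ ^ 2 := norm_sub_mul_re_mul_re_le hf hre ha hwre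
      _ ≤ (δ / (8 * M) * a.re) * (2 * ‖w‖) ^ 2 := by gcongr
      _ = δ / (2 * M) * a.re * ‖w‖ * ‖w‖ := by ring
      _ ≤ δ / (2 * M) * a.re * ‖w‖ * (M * w.re) := by gcongr
      _ = δ / 2 * ‖w‖ * w.re * a.re := by field_simp
  have hfw : ‖f w‖ ≤ ‖f a‖ + ‖f w - f a‖ := norm_le_insert' _ _
  rw [dist_zero_right, norm_div, div_lt_iff₀ hw0]
  have h1 := le_of_mul_le_mul_right hdiff hwre
  rw [div_lt_iff₀ hδ] at hwf
  linarith

theorem exists_isGreatest_tendsto_div :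
    ∃ c : ℝ, IsGreatest {c : ℝ | ∀ w ∈ rightHalfPlane, c * w.re ≤ (f w).re} c ∧
      ∀ M > 0, Tendsto (fun w => f w / w) (Bornology.cobounded ℂ ⊓ 𝓟 (sector M)) (𝓝 c) := by
  set C : Set ℝ := {c | ∀ w ∈ rightHalfPlane, c * w.re ≤ (f w).re}
  have hne : C.Nonempty := ⟨0, fun w hw => by simpa using hre w hw⟩
  have hbdd : BddAbove C := ⟨(f 1).re, fun c hc => by simpa using hc 1 one_mem_rightHalfPlane⟩
  have hmem : sSup C ∈ C := fun w hw =>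
    (le_div_iff₀ hw).mp (csSup_le hne fun c hc => (le_div_iff₀ hw).mpr (hc w hw))
  refine ⟨sSup C, ⟨hmem, fun c hc => le_csSup hbdd hc⟩, fun M hM => ?_⟩
  have hsmall : ∀ ε > 0, ∃ a ∈ rightHalfPlane, (f a - (sSup C : ℝ) * a).re ≤ ε * a.re := by
    intro ε hε
    have hnot : sSup C + ε ∉ C := notMem_of_csSup_lt (by linarith) hbdd
    simp only [C, mem_ofPred_eq, not_forall, not_le] at hnot
    obtain ⟨a, ha, hlt⟩ := hnot
    refine ⟨a, ha, ?_⟩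
    rw [Complex.sub_re, Complex.re_ofReal_mul]
    linarith
  have hlim := (tendsto_div_zero_of_small (hf.sub (differentiableOn_id.const_mul _))
    (fun w hw => by simpa using hmem w hw) hsmall hM).add_const ((sSup C : ℝ) : ℂ)
  rw [zero_add] at hlim
  refine hlim.congr' ?_
  filter_upwards [mem_inf_of_right (mem_principal_self _)] with w hw
  have hw0 : w ≠ 0 := by rintro rfl; simp [sector] at hw
  simp only [Pi.sub_apply]
  field_simp
  ring

end HalfPlane

/-! ### Angular limits -/

theorem stolzRegion_subset_disk (σ : ℂ) (M : ℝ) : stolzRegion σ M ⊆ disk :=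
  fun _ hz => mem_disk.mpr hz.1

theorem nhdsWithin_stolzRegion_neBot {σ : ℂ} (hσ : ‖σ‖ = 1) {M : ℝ} (hM : 1 < M) :
    (𝓝[stolzRegion σ M] σ).NeBot := by
  have hradius : Tendsto (fun r : ℝ => (r : ℂ) * σ) (𝓝[<] 1) (𝓝[stolzRegion σ M] σ) := by
    refine tendsto_nhdsWithin_iff.mpr ⟨?_, ?_⟩
    · have : Continuous (fun r : ℝ => (r : ℂ) * σ) := by fun_prop
      simpa using (this.tendsto 1).mono_left nhdsWithin_le_nhds
    · filter_upwards [Ioo_mem_nhdsLT (zero_lt_one (α := ℝ))] with r hr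
      have h1 : ‖(r : ℂ) * σ‖ = r := by simp [hσ, abs_of_pos hr.1]
      have h2 : ‖σ - (r : ℂ) * σ‖ = 1 - r := by
        have : σ - (r : ℂ) * σ = ((1 - r : ℝ) : ℂ) * σ := by push_cast; ring
        rw [this, norm_mul, hσ, mul_one, Complex.norm_real, Real.norm_of_nonneg]
        linarith [hr.2]
      refine ⟨by rw [h1]; exact hr.2, ?_⟩
      rw [h1, h2]
      nlinarith [hr.2]
  exact hradius.neBot

namespace HasAngularLimit

variable {f g : ℂ → ℂ} {σ a b : ℂ}

theorem unique (hσ : ‖σ‖ = 1) (ha : HasAngularLimit f σ a) (hb : HasAngularLimit f σ b) : a = b :=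
  have := nhdsWithin_stolzRegion_neBot hσ one_lt_two
  tendsto_nhds_unique (ha 2 one_lt_two) (hb 2 one_lt_two)

theorem congr (ha : HasAngularLimit f σ a) (h : EqOn f g disk) : HasAngularLimit g σ a :=
  fun M hM => (ha M hM).congr'
    (eventually_mem_nhdsWithin.mono fun _ hz => h (stolzRegion_subset_disk _ _ hz))

theorem of_continuousAt (h : ContinuousAt f σ) : HasAngularLimit f σ (f σ) :=
  fun _ _ => h.tendsto.mono_left nhdsWithin_le_nhds

theorem const_mul (c : ℂ) (ha : HasAngularLimit f σ a) :
    HasAngularLimit (fun z => c * f z) σ (c * a) := fun M hM => (ha M hM).const_mul c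

theorem mul (ha : HasAngularLimit f σ a) (hb : HasAngularLimit g σ b) :
    HasAngularLimit (fun z => f z * g z) σ (a * b) := fun M hM => (ha M hM).mul (hb M hM)

theorem add (ha : HasAngularLimit f σ a) (hb : HasAngularLimit g σ b) :
    HasAngularLimit (fun z => f z + g z) σ (a + b) := fun M hM => (ha M hM).add (hb M hM)

theorem sub (ha : HasAngularLimit f σ a) (hb : HasAngularLimit g σ b) :
    HasAngularLimit (fun z => f z - g z) σ (a - b) := fun M hM => (ha M hM).sub (hb M hM)

theorem inv (ha : HasAngularLimit f σ a) (h : a ≠ 0) :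
    HasAngularLimit (fun z => (f z)⁻¹) σ a⁻¹ := fun M hM => (ha M hM).inv₀ h

end HasAngularLimit

theorem tendsto_cayley_cobounded {σ : ℂ} (hσ : σ ≠ 0) :
    Tendsto (cayley σ) (𝓝[≠] σ) (Bornology.cobounded ℂ) := by
  have hsub : Tendsto (fun z => σ - z) (𝓝[≠] σ) (𝓝[≠] 0) := by
    refine tendsto_nhdsWithin_iff.mpr ⟨?_, ?_⟩
    · have : Continuous (fun z => σ - z) := by fun_prop
      simpa using (this.tendsto σ).mono_left nhdsWithin_le_nhds
    · exact eventually_mem_nhdsWithin.mono fun z hz => sub_ne_zero.mpr (Ne.symm hz)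
  have hlim : Tendsto (fun z => 2 * σ * (σ - z)⁻¹ - 1) (𝓝[≠] σ) (Bornology.cobounded ℂ) :=
    (tendsto_sub_const_cobounded 1).comp
      ((tendsto_mul_left_cobounded (mul_ne_zero two_ne_zero hσ)).comp
        (tendsto_inv₀_nhdsNE_zero.comp hsub))
  refine hlim.congr' (eventually_mem_nhdsWithin.mono fun z hz => ?_)
  rw [← div_eq_mul_inv, ← cayley_add_one (sub_ne_zero.mpr (Ne.symm hz)), add_sub_cancel_right]

theorem mapsTo_cayley_sector {σ : ℂ} (hσ : ‖σ‖ = 1) {M : ℝ} (hM : 0 < M) :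
    MapsTo (cayley σ) (stolzRegion σ M) (sector (2 * M)) := by
  intro z hz
  have hzd := stolzRegion_subset_disk _ _ hz
  refine ⟨re_cayley_pos hσ hzd, ?_⟩
  have hpos : 0 < ‖σ - z‖ := norm_pos_iff.mpr (sub_ne_zero_of_mem_disk hσ hzd)
  have hsum : ‖σ + z‖ ≤ 2 := (norm_add_le _ _).trans (by linarith [hz.1])
  have hstolz : ‖σ - z‖ ≤ M * (1 - ‖z‖ ^ 2) := by
    refine hz.2.le.trans (mul_le_mul_of_nonneg_left ?_ hM.le)
    nlinarith [norm_nonneg z, hz.1]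
  rw [re_cayley hσ, cayley, norm_div, mul_div_assoc', div_le_div_iff₀ hpos (by positivity)]
  calc ‖σ + z‖ * ‖σ - z‖ ^ 2 ≤ 2 * ‖σ - z‖ ^ 2 := by gcongr
    _ = 2 * ‖σ - z‖ * ‖σ - z‖ := by ring
    _ ≤ 2 * (M * (1 - ‖z‖ ^ 2)) * ‖σ - z‖ := by gcongr
    _ = 2 * M * (1 - ‖z‖ ^ 2) * ‖σ - z‖ := by ring

theorem tendsto_cayley_stolzRegion {σ : ℂ} (hσ : ‖σ‖ = 1) {M : ℝ} (hM : 0 < M) :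
    Tendsto (cayley σ) (𝓝[stolzRegion σ M] σ)
      (Bornology.cobounded ℂ ⊓ 𝓟 (sector (2 * M))) := by
  refine tendsto_inf.mpr ⟨?_, tendsto_principal.mpr ?_⟩
  · refine (tendsto_cayley_cobounded (ne_zero_of_norm_eq_one hσ)).mono_left
      (nhdsWithin_mono σ fun z hz => ?_)
    exact (sub_ne_zero.mp (sub_ne_zero_of_mem_disk hσ (stolzRegion_subset_disk _ _ hz))).symm
  · exact eventually_mem_nhdsWithin.mono fun z hz => mapsTo_cayley_sector hσ hM hz

/-! ### Herglotz functions and their boundary point masses -/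

/-- Herglotz functions: holomorphic functions on the disk with non-negative real part. -/
structure IsHerglotz (h : ℂ → ℂ) : Prop where
  differentiableOn : DifferentiableOn ℂ h disk
  re_nonneg : ∀ z ∈ disk, 0 ≤ (h z).re

/-- The representing measure of the Herglotz function `h` has an atom of mass `m` at `σ`. The
measure itself is not constructed: the mass is read off from the growth of `h` at `σ`, normalized
so that `cayley σ` has mass `1`. -/
def HasPointMass (h : ℂ → ℂ) (σ : ℂ) (m : ℝ) : Prop :=
  HasAngularLimit (fun z => (σ - z) * h z) σ (2 * σ * m)

namespace HasPointMass

variable {h g : ℂ → ℂ} {σ : ℂ} {m l : ℝ}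

theorem unique (hσ : ‖σ‖ = 1) (hm : HasPointMass h σ m) (hl : HasPointMass h σ l) : m = l := by
  have h := HasAngularLimit.unique hσ hm hl
  exact_mod_cast mul_left_cancel₀ (mul_ne_zero two_ne_zero (ne_zero_of_norm_eq_one hσ)) h

theorem congr (hm : HasPointMass h σ m) (hhg : EqOn h g disk) : HasPointMass g σ m :=
  HasAngularLimit.congr hm fun z hz => by simp only [hhg hz]

theorem add (hm : HasPointMass h σ m) (hl : HasPointMass g σ l) :
    HasPointMass (fun z => h z + g z) σ (m + l) := by
  have := HasAngularLimit.add hm hl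
  rw [HasPointMass]
  push_cast
  convert this using 2 <;> ring

theorem const_mul (c : ℝ) (hm : HasPointMass h σ m) :
    HasPointMass (fun z => c * h z) σ (c * m) := by
  have := HasAngularLimit.const_mul c hm
  rw [HasPointMass, Complex.ofReal_mul, mul_left_comm]
  exact this.congr fun z _ => mul_left_comm _ _ _

theorem sub (hm : HasPointMass h σ m) (hl : HasPointMass g σ l) :
    HasPointMass (fun z => h z - g z) σ (m - l) := by
  have := HasAngularLimit.sub hm hl
  rw [HasPointMass]
  push_cast
  convert this using 2 <;> ring

theorem of_continuousAt (hh : ContinuousAt h σ) : HasPointMass h σ 0 := by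
  have hc : ContinuousAt (fun z => (σ - z) * h z) σ := by fun_prop
  simpa [HasPointMass] using HasAngularLimit.of_continuousAt hc

end HasPointMass

theorem hasPointMass_cayley {σ : ℂ} (hσ : ‖σ‖ = 1) : HasPointMass (cayley σ) σ 1 := by
  have h : HasAngularLimit (fun z => σ + z) σ (σ + σ) :=
    HasAngularLimit.of_continuousAt (by fun_prop)
  rw [← two_mul] at h
  rw [HasPointMass, Complex.ofReal_one, mul_one]
  exact h.congr fun z hz => (mul_div_cancel₀ _ (sub_ne_zero_of_mem_disk hσ hz)).symm

theorem continuousAt_cayley {σ τ : ℂ} (hne : τ ≠ σ) : ContinuousAt (cayley τ) σ :=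
  (hasDerivAt_cayley (sub_ne_zero.mpr hne)).continuousAt

theorem isHerglotz_cayley {σ : ℂ} (hσ : ‖σ‖ = 1) : IsHerglotz (cayley σ) :=
  ⟨differentiableOn_cayley hσ, fun _ hz => (re_cayley_pos hσ hz).le⟩

namespace IsHerglotz

variable {h g : ℂ → ℂ} {σ : ℂ} {m : ℝ}

theorem congr (hh : IsHerglotz h) (hhg : EqOn h g disk) : IsHerglotz g :=
  ⟨hh.differentiableOn.congr fun _ hz => (hhg hz).symm, fun z hz => hhg hz ▸ hh.re_nonneg z hz⟩

theorem add (hh : IsHerglotz h) (hg : IsHerglotz g) : IsHerglotz fun z => h z + g z :=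
  ⟨hh.differentiableOn.add hg.differentiableOn,
    fun z hz => add_nonneg (hh.re_nonneg z hz) (hg.re_nonneg z hz)⟩

theorem const {c : ℂ} (hc : 0 ≤ c.re) : IsHerglotz fun _ => c :=
  ⟨differentiableOn_const c, fun _ _ => hc⟩

theorem const_mul (hm : 0 ≤ m) (hh : IsHerglotz h) : IsHerglotz fun z => m * h z :=
  ⟨hh.differentiableOn.const_mul _, fun z hz => by
    simpa using mul_nonneg hm (hh.re_nonneg z hz)⟩

theorem differentiableOn_comp_cayleyInv (hh : IsHerglotz h) (hσ : ‖σ‖ = 1) :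
    DifferentiableOn ℂ (h ∘ cayleyInv σ) rightHalfPlane :=
  hh.differentiableOn.comp (differentiableOn_cayleyInv hσ) (mapsTo_cayleyInv hσ)

theorem re_comp_cayleyInv_nonneg (hh : IsHerglotz h) (hσ : ‖σ‖ = 1) :
    ∀ w ∈ rightHalfPlane, 0 ≤ ((h ∘ cayleyInv σ) w).re :=
  fun _ hw => hh.re_nonneg _ (mapsTo_cayleyInv hσ hw)

theorem eq_of_re_eq_zero (hh : IsHerglotz h) {a z : ℂ} (ha : a ∈ disk) (hz : z ∈ disk)
    (h0 : (h a).re = 0) : h z = h a := by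
  have hinv : ∀ x ∈ disk, (h ∘ cayleyInv 1) (cayley 1 x) = h x := fun x hx => by
    rw [Function.comp_apply, leftInvOn_cayleyInv norm_one hx]
  have := DiskSemigroup.eq_of_re_eq_zero (hh.differentiableOn_comp_cayleyInv norm_one)
    (hh.re_comp_cayleyInv_nonneg norm_one) (mapsTo_cayley norm_one ha) (mapsTo_cayley norm_one hz)
  rw [hinv a ha, hinv z hz] at this
  exact this h0

theorem exists_hasPointMass (hh : IsHerglotz h) (hσ : ‖σ‖ = 1) :
    ∃ m : ℝ, IsGreatest {c : ℝ | ∀ z ∈ disk, c * (cayley σ z).re ≤ (h z).re} m ∧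
      HasPointMass h σ m := by
  have hσ0 := ne_zero_of_norm_eq_one hσ
  have hinv := leftInvOn_cayleyInv hσ
  obtain ⟨m, hgreatest, hlim⟩ := exists_isGreatest_tendsto_div
    (hh.differentiableOn_comp_cayleyInv hσ) (hh.re_comp_cayleyInv_nonneg hσ)
  have hset : {c : ℝ | ∀ z ∈ disk, c * (cayley σ z).re ≤ (h z).re} =
      {c : ℝ | ∀ w ∈ rightHalfPlane, c * w.re ≤ ((h ∘ cayleyInv σ) w).re} := by
    ext c
    refine ⟨fun hc w hw => ?_, fun hc z hz => ?_⟩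
    · simpa [cayley_cayleyInv hσ0 (add_one_ne_zero hw)] using hc _ (mapsTo_cayleyInv hσ hw)
    · simpa [hinv hz] using hc _ (mapsTo_cayley hσ hz)
  refine ⟨m, hset ▸ hgreatest, ?_⟩
  have hquot : HasAngularLimit (fun z => h (cayleyInv σ (cayley σ z)) / cayley σ z) σ m :=
    fun M hM => (hlim (2 * M) (by linarith)).comp
      (tendsto_cayley_stolzRegion hσ (by linarith))
  have hmul := HasAngularLimit.mul (hasPointMass_cayley hσ) hquot
  rw [Complex.ofReal_one, mul_one] at hmul
  refine hmul.congr fun z hz => ?_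
  have hcay : cayley σ z ≠ 0 := fun h0 => by
    simpa [h0] using re_cayley_pos hσ hz
  simp only [hinv hz]
  rw [mul_assoc, mul_div_cancel₀ _ hcay]

theorem isGreatest_of_hasPointMass (hh : IsHerglotz h) (hσ : ‖σ‖ = 1) (hm : HasPointMass h σ m) :
    IsGreatest {c : ℝ | ∀ z ∈ disk, c * (cayley σ z).re ≤ (h z).re} m := by
  obtain ⟨l, hgreatest, hl⟩ := hh.exists_hasPointMass hσ
  exact hl.unique hσ hm ▸ hgreatest

theorem hasPointMass_nonneg (hh : IsHerglotz h) (hσ : ‖σ‖ = 1) (hm : HasPointMass h σ m) :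
    0 ≤ m :=
  (hh.isGreatest_of_hasPointMass hσ hm).2 fun z hz => by simpa using hh.re_nonneg z hz

theorem hasPointMass_mul_re_cayley_le (hh : IsHerglotz h) (hσ : ‖σ‖ = 1)
    (hm : HasPointMass h σ m) {z : ℂ} (hz : z ∈ disk) : m * (cayley σ z).re ≤ (h z).re :=
  (hh.isGreatest_of_hasPointMass hσ hm).1 z hz

theorem hasPointMass_le_re_zero (hh : IsHerglotz h) (hσ : ‖σ‖ = 1) (hm : HasPointMass h σ m) :
    m ≤ (h 0).re := by
  simpa [cayley_zero hσ] using hh.hasPointMass_mul_re_cayley_le hσ hm zero_mem_disk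

theorem sub_mul_cayley (hh : IsHerglotz h) (hσ : ‖σ‖ = 1) (hm : HasPointMass h σ m) :
    IsHerglotz fun z => h z - m * cayley σ z :=
  ⟨hh.differentiableOn.sub ((differentiableOn_cayley hσ).const_mul _), fun z hz => by
    simpa using hh.hasPointMass_mul_re_cayley_le hσ hm hz⟩

theorem sub_sum_mul_cayley {ι : Type*} {s : Finset ι} {σ : ι → ℂ} {m : ι → ℝ}
    (hh : IsHerglotz h) (hσ : ∀ k ∈ s, ‖σ k‖ = 1) (hinj : InjOn σ s)
    (hm : ∀ k ∈ s, HasPointMass h (σ k) (m k)) :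
    IsHerglotz fun z => h z - ∑ k ∈ s, m k * cayley (σ k) z := by
  classical
  induction s using Finset.induction_on with
  | empty => simpa using hh
  | insert a s ha ih =>
    have hrest := ih (fun k hk => hσ k (Finset.mem_insert_of_mem hk))
      (hinj.mono (by simp)) (fun k hk => hm k (Finset.mem_insert_of_mem hk))
    have hcont : ContinuousAt (fun z => ∑ k ∈ s, m k * cayley (σ k) z) (σ a) := by
      refine tendsto_finsetSum _ fun k hk => ?_
      have hne : σ k ≠ σ a := fun he =>
        ha (hinj (by simp [hk]) (by simp) he ▸ hk)
      exact (continuousAt_cayley hne).tendsto.const_mul _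
    have hmass := (hm a (Finset.mem_insert_self a s)).sub (.of_continuousAt hcont)
    rw [sub_zero] at hmass
    refine (hrest.sub_mul_cayley (hσ a (Finset.mem_insert_self a s)) hmass).congr fun z _ => ?_
    simp only [Finset.sum_insert ha]
    ring

theorem sub_sum_mul_cayley_of_le {ι : Type*} {s : Finset ι} {σ : ι → ℂ} {a m : ι → ℝ}
    (hh : IsHerglotz h) (hσ : ∀ k ∈ s, ‖σ k‖ = 1) (hinj : InjOn σ s)
    (hm : ∀ k ∈ s, HasPointMass h (σ k) (m k)) (ham : ∀ k ∈ s, a k ≤ m k) :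
    IsHerglotz fun z => h z - ∑ k ∈ s, a k * cayley (σ k) z := by
  refine ⟨hh.differentiableOn.sub
    (.fun_sum fun k hk => (differentiableOn_cayley (hσ k hk)).const_mul _), fun z hz => ?_⟩
  refine ((hh.sub_sum_mul_cayley hσ hinj hm).re_nonneg z hz).trans ?_
  simp only [Complex.sub_re, Complex.re_sum, Complex.re_ofReal_mul]
  exact sub_le_sub_left (Finset.sum_le_sum fun k hk =>
    mul_le_mul_of_nonneg_right (ham k hk) (re_cayley_pos (hσ k hk) hz).le) _

theorem eqOn_of_hasPointMass_re_zero (hh : IsHerglotz h) (hσ : ‖σ‖ = 1)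
    (hm : HasPointMass h σ (h 0).re) :
    EqOn h (fun z => (h 0).re * cayley σ z + (h 0).im * Complex.I) disk := by
  intro z hz
  have hconst := (hh.sub_mul_cayley hσ hm).eq_of_re_eq_zero zero_mem_disk hz
    (by simp [cayley_zero hσ])
  rw [cayley_zero hσ, sub_eq_iff_eq_add] at hconst
  linear_combination hconst - Complex.re_add_im (h 0)

end IsHerglotz

/-! ### Boundary fixed points of self-maps of the disk -/

section BoundaryFixedPoint

variable {f : ℂ → ℂ} {σ : ℂ} (hσ : ‖σ‖ = 1)

include hσ

theorem HasAngularDerivAtFixed.hasAngularLimit {d : ℂ} (hd : HasAngularDerivAtFixed f σ d) :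
    HasAngularLimit f σ σ := by
  have hsub : HasAngularLimit (fun z => z - σ) σ (σ - σ) :=
    HasAngularLimit.of_continuousAt (f := fun z => z - σ) (by fun_prop)
  have hlim := (HasAngularLimit.mul hd hsub).add
    (HasAngularLimit.of_continuousAt (f := fun _ => σ) (by fun_prop))
  rw [sub_self, mul_zero, zero_add] at hlim
  refine hlim.congr fun z hz => ?_
  have hne : z - σ ≠ 0 := sub_ne_zero.mpr (sub_ne_zero.mp (sub_ne_zero_of_mem_disk hσ hz)).symm
  simp only [div_mul_cancel₀ _ hne, sub_add_cancel]

theorem HasAngularDerivAtFixed.of_hasPointMass (hmap : MapsTo f disk disk) {m : ℝ} (hm0 : m ≠ 0)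
    (hm : HasPointMass (cayley σ ∘ f) σ m) : HasAngularDerivAtFixed f σ ((m⁻¹ : ℝ) : ℂ) := by
  have hσ0 := ne_zero_of_norm_eq_one hσ
  have hm0' : (m : ℂ) ≠ 0 := Complex.ofReal_ne_zero.mpr hm0
  have hadd := hm.add (HasPointMass.of_continuousAt (h := fun _ => 1) (by fun_prop))
  rw [add_zero] at hadd
  have hlim := (HasAngularLimit.inv hadd
    (mul_ne_zero (mul_ne_zero two_ne_zero hσ0) hm0')).const_mul (2 * σ)
  have hval : 2 * σ * (2 * σ * (m : ℂ))⁻¹ = ((m⁻¹ : ℝ) : ℂ) := by push_cast; field_simp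
  rw [hval] at hlim
  refine hlim.congr fun z hz => ?_
  have hz' := sub_ne_zero_of_mem_disk hσ hz
  have hfz := sub_ne_zero_of_mem_disk hσ (hmap hz)
  simp only [Function.comp_apply]
  rw [cayley_add_one hfz, ← neg_sub σ z, ← neg_sub σ (f z), neg_div_neg_eq]
  field_simp

theorem HasAngularDerivAtFixed.hasPointMass_mul_eq_one (hmap : MapsTo f disk disk) {m : ℝ} {d : ℂ}
    (hm : HasPointMass (cayley σ ∘ f) σ m) (hd : HasAngularDerivAtFixed f σ d) : m * d = 1 := by
  have hσ0 := ne_zero_of_norm_eq_one hσ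
  have hlim : HasAngularLimit (fun z => σ + f z) σ (2 * σ * m * d) := by
    refine (HasAngularLimit.mul hm hd).congr fun z hz => ?_
    have hz' := sub_ne_zero_of_mem_disk hσ hz
    have hfz := sub_ne_zero_of_mem_disk hσ (hmap hz)
    simp only [Function.comp_apply, cayley]
    rw [← neg_sub σ z, ← neg_sub σ (f z), neg_div_neg_eq]
    field_simp
  have hsum := (HasAngularLimit.of_continuousAt (f := fun _ => σ) (by fun_prop)).add
    (hd.hasAngularLimit hσ)
  refine mul_left_cancel₀ (mul_ne_zero two_ne_zero hσ0) ?_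
  linear_combination hlim.unique hσ hsum

theorem isHerglotz_cayley_comp (hf : DifferentiableOn ℂ f disk) (hmap : MapsTo f disk disk) :
    IsHerglotz (cayley σ ∘ f) :=
  ⟨(differentiableOn_cayley hσ).comp hf hmap, fun _ hz => (re_cayley_pos hσ (hmap hz)).le⟩

theorem exists_hasAngularDerivAtFixed_le (hf : DifferentiableOn ℂ f disk)
    (hmap : MapsTo f disk disk) {c : ℝ} (hc : 0 < c)
    (hle : ∀ z ∈ disk, c * (cayley σ z).re ≤ (cayley σ (f z)).re) :
    ∃ d : ℝ, HasAngularDerivAtFixed f σ d ∧ d ≤ c⁻¹ := by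
  obtain ⟨m, hgreatest, hm⟩ := (isHerglotz_cayley_comp hσ hf hmap).exists_hasPointMass hσ
  have hcm : c ≤ m := hgreatest.2 hle
  exact ⟨m⁻¹, .of_hasPointMass hσ hmap (hc.trans_le hcm).ne' hm, by gcongr⟩

theorem isBRFP_of_mul_re_cayley_le (hf : DifferentiableOn ℂ f disk)
    (hmap : MapsTo f disk disk) {c : ℝ} (hc : 0 < c)
    (hle : ∀ z ∈ disk, c * (cayley σ z).re ≤ (cayley σ (f z)).re) : IsBRFP f σ :=
  let ⟨d, hd, _⟩ := exists_hasAngularDerivAtFixed_le hσ hf hmap hc hle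
  ⟨hσ, hd.hasAngularLimit hσ, d, hd⟩

theorem isDWPointOfMap_of_re_cayley_lt (hf : DifferentiableOn ℂ f disk)
    (hmap : MapsTo f disk disk) (hlt : ∀ z ∈ disk, (cayley σ z).re < (cayley σ (f z)).re) :
    IsDWPointOfMap f σ := by
  have hle : ∀ z ∈ disk, 1 * (cayley σ z).re ≤ (cayley σ (f z)).re :=
    fun z hz => by simpa using (hlt z hz).le
  obtain ⟨d, hd, hd1⟩ := exists_hasAngularDerivAtFixed_le hσ hf hmap one_pos hle
  refine Or.inr ⟨fun z hz hfix => ?_, isBRFP_of_mul_re_cayley_le hσ hf hmap one_pos hle, d, hd,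
    by simpa using hd1⟩
  have h := hlt z hz
  rw [hfix] at h
  exact h.false

theorem IsDWPointOfMap.re_cayley_le (hf : DifferentiableOn ℂ f disk) (hmap : MapsTo f disk disk)
    (h : IsDWPointOfMap f σ) {z : ℂ} (hz : z ∈ disk) :
    (cayley σ z).re ≤ (cayley σ (f z)).re := by
  rcases h with ⟨hmem, -⟩ | ⟨-, -, d, hd, hd1⟩
  · exact absurd hσ (mem_disk.mp hmem).ne
  have hherglotz := isHerglotz_cayley_comp hσ hf hmap
  obtain ⟨m, -, hm⟩ := hherglotz.exists_hasPointMass hσ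
  have hmd : m * d = 1 := by exact_mod_cast hd.hasPointMass_mul_eq_one hσ hmap hm
  have hm1 : 1 ≤ m := by nlinarith [hherglotz.hasPointMass_nonneg hσ hm]
  calc (cayley σ z).re ≤ m * (cayley σ z).re :=
        le_mul_of_one_le_left (re_cayley_pos hσ hz).le hm1
    _ ≤ (cayley σ (f z)).re := hherglotz.hasPointMass_mul_re_cayley_le hσ hm hz

end BoundaryFixedPoint

/-! ### Koenigs functions -/

/-- `K` is a Koenigs function of the vector field `v` on the open set `U`: an injective holomorphic
coordinate in which `v` becomes the constant field `1`, so that the flow of `v` becomes translation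
along the real axis. -/
structure IsKoenigs (K v : ℂ → ℂ) (U : Set ℂ) : Prop where
  isOpen : IsOpen U
  ne_zero : ∀ z ∈ U, v z ≠ 0
  hasDerivAt : ∀ z ∈ U, HasDerivAt K (v z)⁻¹ z
  injOn : InjOn K U

/-- The flow that `K` conjugates to the translations `y ↦ y + t`; it is meaningful at `z ∈ U` as
long as `K z + t` stays in the image of `U`. -/
noncomputable def koenigsFlow (K : ℂ → ℂ) (U : Set ℂ) (t : ℝ) (z : ℂ) : ℂ :=
  Function.invFunOn K U (K z + t)

namespace IsKoenigs

variable {K v : ℂ → ℂ} {U : Set ℂ} {z : ℂ} {t : ℝ}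

theorem invFunOn_apply (hK : IsKoenigs K v U) (hz : z ∈ U) : Function.invFunOn K U (K z) = z :=
  hK.injOn.leftInvOn_invFunOn hz

theorem hasStrictDerivAt (hK : IsKoenigs K v U) (hz : z ∈ U) : HasStrictDerivAt K (v z)⁻¹ z := by
  have hd : DifferentiableOn ℂ K U :=
    fun w hw => (hK.hasDerivAt w hw).differentiableAt.differentiableWithinAt
  rw [← (hK.hasDerivAt z hz).deriv]
  exact (hd.analyticAt (hK.isOpen.mem_nhds hz)).hasStrictDerivAt

theorem image_mem_nhds (hK : IsKoenigs K v U) (hz : z ∈ U) {V : Set ℂ} (hV : V ∈ 𝓝 z) :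
    K '' V ∈ 𝓝 (K z) := by
  rw [← (hK.hasStrictDerivAt hz).map_nhds_eq (inv_ne_zero (hK.ne_zero z hz))]
  exact image_mem_map hV

theorem isOpen_image (hK : IsKoenigs K v U) : IsOpen (K '' U) :=
  isOpen_iff_mem_nhds.mpr fun _ ⟨_, hz, hzy⟩ =>
    hzy ▸ hK.image_mem_nhds hz (hK.isOpen.mem_nhds hz)

theorem hasDerivAt_invFunOn (hK : IsKoenigs K v U) (hz : z ∈ U) :
    HasDerivAt (Function.invFunOn K U) (v z) (K z) := by
  have hcont : ContinuousAt (Function.invFunOn K U) (K z) := by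
    rw [ContinuousAt, hK.invFunOn_apply hz]
    refine tendsto_def.mpr fun V hV => ?_
    filter_upwards [hK.image_mem_nhds hz (inter_mem hV (hK.isOpen.mem_nhds hz))]
    rintro _ ⟨w, ⟨hwV, hwU⟩, rfl⟩
    rwa [mem_preimage, hK.invFunOn_apply hwU]
  have hright : ∀ᶠ y in 𝓝 (K z), K (Function.invFunOn K U y) = y :=
    Filter.mem_of_superset (hK.image_mem_nhds hz (hK.isOpen.mem_nhds hz))
      fun _ hy => Function.invFunOn_eq hy
  have h := HasDerivAt.of_local_left_inverse (f := K) (f' := (v z)⁻¹) hcont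
    (by rw [hK.invFunOn_apply hz]; exact hK.hasDerivAt z hz) (inv_ne_zero (hK.ne_zero z hz)) hright
  rwa [inv_inv] at h

theorem koenigsFlow_zero (hK : IsKoenigs K v U) (hz : z ∈ U) : koenigsFlow K U 0 z = z := by
  rw [koenigsFlow, Complex.ofReal_zero, add_zero, hK.invFunOn_apply hz]

theorem hasDerivAt_koenigsFlow (hK : IsKoenigs K v U) (ht : K z + t ∈ K '' U) :
    HasDerivAt (fun s => koenigsFlow K U s z) (v (koenigsFlow K U t z)) t := by
  obtain ⟨w, hw, hwt⟩ := ht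
  have hinv := hK.hasDerivAt_invFunOn hw
  rw [koenigsFlow, ← hwt, hK.invFunOn_apply hw]
  rw [hwt] at hinv
  have htrans : HasDerivAt (fun s : ℝ => K z + s) 1 t := by
    simpa using Complex.ofRealCLM.hasDerivAt.const_add (K z) (x := t)
  have h := hinv.comp t htrans
  rw [mul_one] at h
  exact h

theorem differentiableAt_koenigsFlow (hK : IsKoenigs K v U) (hz : z ∈ U)
    (ht : K z + t ∈ K '' U) : DifferentiableAt ℂ (koenigsFlow K U t) z := by
  obtain ⟨w, hw, hwt⟩ := ht
  have hinv := hK.hasDerivAt_invFunOn hw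
  rw [hwt] at hinv
  exact (hinv.comp z ((hK.hasDerivAt z hz).add_const (t : ℂ))).differentiableAt

end IsKoenigs

theorem koenigsFlow_mem {K : ℂ → ℂ} {U : Set ℂ} {z : ℂ} {t : ℝ} (ht : K z + t ∈ K '' U) :
    koenigsFlow K U t z ∈ U := Function.invFunOn_mem ht

theorem apply_koenigsFlow {K : ℂ → ℂ} {U : Set ℂ} {z : ℂ} {t : ℝ} (ht : K z + t ∈ K '' U) :
    K (koenigsFlow K U t z) = K z + t := Function.invFunOn_eq ht

theorem koenigsFlow_add {K : ℂ → ℂ} {U : Set ℂ} {z : ℂ} {s t : ℝ} (ht : K z + t ∈ K '' U) :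
    koenigsFlow K U (s + t) z = koenigsFlow K U s (koenigsFlow K U t z) := by
  rw [koenigsFlow, koenigsFlow, apply_koenigsFlow ht]
  push_cast
  ring_nf

/-- The Noshiro–Warschawski theorem. -/
theorem injOn_of_re_deriv_pos {U : Set ℂ} (hU : Convex ℝ U) {H H' : ℂ → ℂ}
    (hH : ∀ z ∈ U, HasDerivAt H (H' z) z) (hpos : ∀ z ∈ U, 0 < (H' z).re) : InjOn H U := by
  intro a ha b hb hab
  by_contra hne
  have hne' : b - a ≠ 0 := sub_ne_zero.mpr (Ne.symm hne)
  have hmem : ∀ s ∈ Icc (0 : ℝ) 1, a + s * (b - a) ∈ U := fun s hs => by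
    simpa using hU.add_smul_sub_mem ha hb hs
  have hder : ∀ s ∈ Icc (0 : ℝ) 1,
      HasDerivAt (fun s : ℝ => (H (a + s * (b - a)) / (b - a)).re) (H' (a + s * (b - a))).re s := by
    intro s hs
    have hline : HasDerivAt (fun s : ℝ => a + s * (b - a)) (b - a) s := by
      simpa using (Complex.ofRealCLM.hasDerivAt.mul_const (b - a)).const_add a (x := s)
    have hquot := ((hH _ (hmem s hs)).comp s hline).div_const (b - a)
    rw [mul_div_cancel_right₀ _ hne'] at hquot
    exact Complex.reCLM.hasFDerivAt.comp_hasDerivAt s hquot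
  have hmono := strictMonoOn_of_hasDerivWithinAt_pos (convex_Icc (0 : ℝ) 1)
    (fun s hs => (hder s hs).continuousAt.continuousWithinAt)
    (fun s hs => (hder s (interior_subset hs)).hasDerivWithinAt)
    (fun s hs => hpos _ (hmem s (interior_subset hs)))
  have := hmono (left_mem_Icc.mpr zero_le_one) (right_mem_Icc.mpr zero_le_one) zero_lt_one
  simp [hab] at this

/-! ### Vector fields on the half-plane with non-negative real part -/

section IntegralCurve

variable {f : ℂ → ℂ} (hf : DifferentiableOn ℂ f rightHalfPlane)
  (hre : ∀ w ∈ rightHalfPlane, 0 ≤ (f w).re) {γ : ℝ → ℂ} {T : ℝ}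
  (hmem : ∀ t ∈ Icc 0 T, γ t ∈ rightHalfPlane) (hγ : ∀ t ∈ Icc 0 T, HasDerivAt γ (f (γ t)) t)

include hre hmem hγ

theorem monotoneOn_re_integralCurve : MonotoneOn (fun t => (γ t).re) (Icc 0 T) := by
  have hder : ∀ t ∈ Icc 0 T, HasDerivAt (fun t => (γ t).re) (f (γ t)).re t :=
    fun t ht => Complex.reCLM.hasFDerivAt.comp_hasDerivAt t (hγ t ht)
  exact monotoneOn_of_hasDerivWithinAt_nonneg (convex_Icc 0 T)
    (fun t ht => (hder t ht).continuousAt.continuousWithinAt)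
    (fun t ht => (hder t (interior_subset ht)).hasDerivWithinAt)
    (fun t ht => hre _ (hmem t (interior_subset ht)))

include hf

/-- The quotient is the square of the hyperbolic speed of `γ`, which by the Schwarz–Pick lemma the
flow does not increase. -/
theorem antitoneOn_norm_sq_div_re_sq_integralCurve :
    AntitoneOn (fun t => ‖f (γ t)‖ ^ 2 / (γ t).re ^ 2) (Icc 0 T) := by
  have hf' : ∀ t ∈ Icc 0 T, HasDerivAt f (deriv f (γ t)) (γ t) := fun t ht =>
    (hf.differentiableAt (isOpen_rightHalfPlane.mem_nhds (hmem t ht))).hasDerivAt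
  have hder : ∀ t ∈ Icc 0 T, HasDerivAt (fun t => ‖f (γ t)‖ ^ 2 / (γ t).re ^ 2) _ t := fun t ht =>
    (((hf' t ht).comp t (hγ t ht)).norm_sq).div
      ((Complex.reCLM.hasFDerivAt.comp_hasDerivAt t (hγ t ht)).pow 2)
      (pow_ne_zero 2 (mem_rightHalfPlane.mp (hmem t ht)).ne')
  refine antitoneOn_of_hasDerivWithinAt_nonpos (convex_Icc 0 T)
    (fun t ht => (hder t ht).continuousAt.continuousWithinAt)
    (fun t ht => (hder t (interior_subset ht)).hasDerivWithinAt) fun t ht => ?_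
  have ht' := interior_subset ht
  refine div_nonpos_of_nonpos_of_nonneg ?_ (by positivity)
  simp only [Function.comp_apply, Complex.reCLM_apply]
  have hpick := norm_deriv_mul_re_le hf hre (hmem t ht') (hf' t ht')
  have hpos := mem_rightHalfPlane.mp (hmem t ht')
  set w := γ t
  have hinner : inner ℝ (f w) (deriv f w * f w) ≤ ‖deriv f w‖ * ‖f w‖ ^ 2 :=
    (real_inner_le_norm _ _).trans (by rw [norm_mul]; exact le_of_eq (by ring))
  have h1 : 0 ≤ ‖f w‖ ^ 2 * w.re * ((f w).re - ‖deriv f w‖ * w.re) := by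
    have := sub_nonneg.mpr hpick
    positivity
  have h2 := mul_le_mul_of_nonneg_right hinner (sq_nonneg w.re)
  rw [Nat.cast_ofNat, Nat.add_one_sub_one, pow_one]
  linarith

theorem norm_integralCurve_le (hT : 0 ≤ T) :
    ‖γ T‖ ≤ ‖γ 0‖ * Real.exp (‖f (γ 0)‖ / (γ 0).re * T) := by
  have h0 : (0 : ℝ) ∈ Icc 0 T := left_mem_Icc.mpr hT
  have hspeed : ∀ t ∈ Icc 0 T, ‖f (γ t)‖ ≤ ‖f (γ 0)‖ / (γ 0).re * ‖γ t‖ := by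
    intro t ht
    have hre_pos := mem_rightHalfPlane.mp (hmem t ht)
    have hre0_pos := mem_rightHalfPlane.mp (hmem 0 h0)
    have hanti := antitoneOn_norm_sq_div_re_sq_integralCurve hf hre hmem hγ h0 ht ht.1
    simp only [← div_pow] at hanti
    have hquot : ‖f (γ t)‖ / (γ t).re ≤ ‖f (γ 0)‖ / (γ 0).re :=
      le_of_sq_le_sq hanti (by positivity)
    calc ‖f (γ t)‖ ≤ ‖f (γ 0)‖ / (γ 0).re * (γ t).re := (div_le_iff₀ hre_pos).mp hquot
      _ ≤ ‖f (γ 0)‖ / (γ 0).re * ‖γ t‖ := by gcongr; exact Complex.re_le_norm _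
  have h := norm_le_gronwallBound_of_norm_deriv_right_le (δ := ‖γ 0‖) (ε := 0)
    (fun t ht => (hγ t ht).continuousAt.continuousWithinAt)
    (fun t ht => (hγ t (Ico_subset_Icc_self ht)).hasDerivWithinAt) le_rfl
    (fun t ht => by simpa using hspeed t (Ico_subset_Icc_self ht)) T (right_mem_Icc.mpr hT)
  rwa [gronwallBound_ε0, sub_zero] at h

end IntegralCurve

theorem add_mem_image_of_forall_lt {f H : ℂ → ℂ} (hf : DifferentiableOn ℂ f rightHalfPlane)
    (hre : ∀ w ∈ rightHalfPlane, 0 ≤ (f w).re) (hH : IsKoenigs H f rightHalfPlane) {w : ℂ}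
    (hw : w ∈ rightHalfPlane) {T : ℝ} (hT : 0 < T)
    (hlt : ∀ s ∈ Ico 0 T, H w + (s : ℝ) ∈ H '' rightHalfPlane) :
    H w + T ∈ H '' rightHalfPlane := by
  set γ : ℝ → ℂ := fun s => koenigsFlow H rightHalfPlane s w
  have hγ0 : γ 0 = w := hH.koenigsFlow_zero hw
  set A := ‖f w‖ / w.re
  have hA : 0 ≤ A := div_nonneg (norm_nonneg _) (mem_rightHalfPlane.mp hw).le
  -- `C` is a compact part of the half-plane which the trajectory does not leave before time `T`.
  let C : Set ℂ := Metric.closedBall 0 (‖w‖ * Real.exp (A * T)) ∩ {v | w.re ≤ v.re}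
  have hCsub : C ⊆ rightHalfPlane := fun v hv => (mem_rightHalfPlane.mp hw).trans_le hv.2
  have hC : IsCompact C := (isCompact_closedBall _ _).inter_right
    (isClosed_le continuous_const Complex.continuous_re)
  have hHC : IsClosed (H '' C) := (hC.image_of_continuousOn fun v hv =>
    (hH.hasDerivAt v (hCsub hv)).continuousAt.continuousWithinAt).isClosed
  have hmemC : ∀ s ∈ Ico 0 T, H w + (s : ℝ) ∈ H '' C := by
    intro s hs
    have hs' : ∀ r ∈ Icc 0 s, H w + (r : ℝ) ∈ H '' rightHalfPlane :=
      fun r hr => hlt r ⟨hr.1, hr.2.trans_lt hs.2⟩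
    have hmem : ∀ r ∈ Icc 0 s, γ r ∈ rightHalfPlane := fun r hr => koenigsFlow_mem (hs' r hr)
    have hγ : ∀ r ∈ Icc 0 s, HasDerivAt γ (f (γ r)) r :=
      fun r hr => hH.hasDerivAt_koenigsFlow (hs' r hr)
    refine ⟨γ s, ⟨?_, ?_⟩, apply_koenigsFlow (hlt s hs)⟩
    · have hnorm := norm_integralCurve_le hf hre hmem hγ hs.1
      rw [hγ0] at hnorm
      refine mem_closedBall_zero_iff.mpr (hnorm.trans ?_)
      have := hs.2.le
      gcongr
    · have hmono := monotoneOn_re_integralCurve hre hmem hγ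
        (left_mem_Icc.mpr hs.1) (right_mem_Icc.mpr hs.1) hs.1
      simp only [hγ0] at hmono
      exact hmono
  have hlim : Tendsto (fun s : ℝ => H w + (s : ℂ)) (𝓝[<] T) (𝓝 (H w + T)) :=
    (Continuous.tendsto (by fun_prop) T).mono_left nhdsWithin_le_nhds
  exact image_mono hCsub (hHC.mem_of_tendsto hlim
    (mem_of_superset (Ico_mem_nhdsLT hT) hmemC))

theorem add_mem_image_rightHalfPlane {f H : ℂ → ℂ} (hf : DifferentiableOn ℂ f rightHalfPlane)
    (hre : ∀ w ∈ rightHalfPlane, 0 ≤ (f w).re) (hH : IsKoenigs H f rightHalfPlane) {w : ℂ}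
    (hw : w ∈ rightHalfPlane) {t : ℝ} (ht : 0 ≤ t) : H w + t ∈ H '' rightHalfPlane := by
  by_contra hexit
  set S : Set ℝ := {t | 0 ≤ t ∧ H w + (t : ℝ) ∉ H '' rightHalfPlane}
  have hclosed : IsClosed S :=
    isClosed_Ici.inter (hH.isOpen_image.isClosed_compl.preimage (by fun_prop))
  have hbdd : BddBelow S := ⟨0, fun s hs => hs.1⟩
  obtain ⟨hnonneg, hnot⟩ : sInf S ∈ S := hclosed.csInf_mem ⟨t, ht, hexit⟩ hbdd
  have hpos : 0 < sInf S := by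
    refine hnonneg.lt_of_ne fun h0 => hnot ?_
    rw [← h0, Complex.ofReal_zero, add_zero]
    exact mem_image_of_mem H hw
  refine hnot (add_mem_image_of_forall_lt hf hre hH hw hpos fun s hs => ?_)
  by_contra hs'
  exact hs.2.not_ge (csInf_le hbdd ⟨hs.1, hs'⟩)

/-- The vector field `G` in the coordinate `w = cayley τ z` of the right half-plane. -/
noncomputable def cayleyField (τ : ℂ) (G : ℂ → ℂ) (w : ℂ) : ℂ :=
  2 * τ * G (cayleyInv τ w) / (τ - cayleyInv τ w) ^ 2

theorem hasDerivAt_comp_cayleyInv {K G : ℂ → ℂ} {τ w : ℂ} (hτ : ‖τ‖ = 1)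
    (hw : w ∈ rightHalfPlane) (hK : HasDerivAt K (G (cayleyInv τ w))⁻¹ (cayleyInv τ w)) :
    HasDerivAt (K ∘ cayleyInv τ) (cayleyField τ G w)⁻¹ w := by
  refine (hK.comp w (hasDerivAt_cayleyInv (ne_zero_of_norm_eq_one hτ)
    (add_one_ne_zero hw))).congr_deriv ?_
  rw [cayleyField, inv_div, div_eq_mul_inv, div_eq_mul_inv, mul_inv]
  ring

section BerksonPortaFlow

variable {τ : ℂ} {G : ℂ → ℂ} (hτ : ‖τ‖ = 1) (hG : DifferentiableOn ℂ G disk)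
  (hpos : ∀ z ∈ disk, 0 < (τ * G z / (τ - z) ^ 2).re)

include hτ hG in
theorem differentiableOn_cayleyField : DifferentiableOn ℂ (cayleyField τ G) rightHalfPlane :=
  ((hG.comp (differentiableOn_cayleyInv hτ) (mapsTo_cayleyInv hτ)).const_mul _).div
    (((differentiableOn_cayleyInv hτ).const_sub τ).pow 2)
    fun _ hw => pow_ne_zero 2 (sub_ne_zero_of_mem_disk hτ (mapsTo_cayleyInv hτ hw))

include hτ hpos in
theorem re_cayleyField_pos {w : ℂ} (hw : w ∈ rightHalfPlane) : 0 < (cayleyField τ G w).re := by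
  have h := hpos _ (mapsTo_cayleyInv hτ hw)
  rw [cayleyField, mul_assoc, mul_div_assoc]
  simpa using h

include hτ hG hpos

theorem exists_isKoenigs_disk : ∃ K, IsKoenigs K G disk ∧
    ∀ z ∈ disk, ∀ t : ℝ, 0 ≤ t → K z + t ∈ K '' disk := by
  have hG0 : ∀ z ∈ disk, G z ≠ 0 := fun z hz h0 => by simpa [h0] using hpos z hz
  obtain ⟨K, hK⟩ : Complex.IsExactOn (fun z => (G z)⁻¹) disk := (hG.inv hG0).isExactOn_ball
  set H := K ∘ cayleyInv τ
  have hKH : EqOn (H ∘ cayley τ) K disk := fun z hz =>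
    congrArg K (leftInvOn_cayleyInv hτ hz)
  have hHderiv : ∀ w ∈ rightHalfPlane, HasDerivAt H (cayleyField τ G w)⁻¹ w := fun w hw =>
    hasDerivAt_comp_cayleyInv hτ hw (hK _ (mapsTo_cayleyInv hτ hw))
  have hHinj : InjOn H rightHalfPlane := injOn_of_re_deriv_pos convex_rightHalfPlane hHderiv
    fun w hw => re_inv_pos (re_cayleyField_pos hτ hpos hw)
  have hH : IsKoenigs H (cayleyField τ G) rightHalfPlane :=
    ⟨isOpen_rightHalfPlane, fun w hw h0 => by simpa [h0] using re_cayleyField_pos hτ hpos hw,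
      hHderiv, hHinj⟩
  refine ⟨K, ⟨isOpen_disk, hG0, hK, ?_⟩, fun z hz t ht => ?_⟩
  · exact (hHinj.comp (leftInvOn_cayleyInv hτ).injOn (mapsTo_cayley hτ)).congr hKH
  · obtain ⟨v, hv, hvt⟩ := add_mem_image_rightHalfPlane (differentiableOn_cayleyField hτ hG)
      (fun w hw => (re_cayleyField_pos hτ hpos hw).le) hH (mapsTo_cayley hτ hz) ht
    refine ⟨cayleyInv τ v, mapsTo_cayleyInv hτ hv, hvt.trans ?_⟩
    rw [← hKH hz, Function.comp_apply]

theorem exists_isSemigroup_isGenerator : ∃ φ, IsSemigroup φ ∧ IsGenerator φ G := by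
  obtain ⟨K, hK, hinv⟩ := exists_isKoenigs_disk hτ hG hpos
  have hderiv : ∀ z ∈ disk, ∀ t : ℝ, 0 ≤ t → HasDerivAt (fun s => koenigsFlow K disk s z)
      (G (koenigsFlow K disk t z)) t :=
    fun z hz t ht => hK.hasDerivAt_koenigsFlow (hinv z hz t ht)
  refine ⟨koenigsFlow K disk,
    ⟨fun t ht z hz => ?_, fun t ht z hz => koenigsFlow_mem (hinv z hz t ht),
      fun z hz => hK.koenigsFlow_zero hz,
      fun s t _ ht z hz => koenigsFlow_add (hinv z hz t ht), fun z hz => ?_⟩, hG,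
    fun z hz t ht => (hderiv z hz t ht).hasDerivWithinAt⟩
  · exact (hK.differentiableAt_koenigsFlow hz (hinv z hz t ht)).differentiableWithinAt
  · have hcont := (hderiv z hz 0 le_rfl).continuousAt.tendsto
    rw [hK.koenigsFlow_zero hz] at hcont
    exact hcont.mono_left nhdsWithin_le_nhds

end BerksonPortaFlow

/-! ### The Berkson–Porta formula -/

/-- The Berkson–Porta transform at a boundary point `τ`. For `‖τ‖ = 1` it is an involution; it takes
the generators `G z = (τ - z) * (1 - conj τ * z) / p z` with Denjoy–Wolff point `τ` to their
Herglotz functions `p`, and back. -/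
noncomputable def berksonPorta (τ : ℂ) (G : ℂ → ℂ) (z : ℂ) : ℂ := (τ - z) ^ 2 / (τ * G z)

theorem norm_sub_sq_mul_mul {τ σ : ℂ} (hτ : ‖τ‖ = 1) (hσ : ‖σ‖ = 1) :
    ((‖τ - σ‖ ^ 2 : ℝ) : ℂ) * (τ * σ) = -(τ - σ) ^ 2 := by
  have hτ' : τ * conj τ = 1 := by simp [Complex.mul_conj', hτ]
  have hσ' : σ * conj σ = 1 := by simp [Complex.mul_conj', hσ]
  rw [Complex.ofReal_pow, ← Complex.mul_conj', map_sub]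
  linear_combination (τ - σ) * σ * hτ' - (τ - σ) * τ * hσ'

theorem berksonPorta_berksonPorta {τ : ℂ} (hτ : ‖τ‖ = 1) (G : ℂ → ℂ) :
    EqOn (berksonPorta τ (berksonPorta τ G)) G disk := by
  intro z hz
  have hτ0 := ne_zero_of_norm_eq_one hτ
  have hsub := sub_ne_zero_of_mem_disk hτ hz
  rw [berksonPorta, berksonPorta]
  field_simp

theorem differentiableOn_berksonPorta {τ : ℂ} (hτ : ‖τ‖ = 1) {G : ℂ → ℂ}
    (hG : DifferentiableOn ℂ G disk) (hG0 : ∀ z ∈ disk, G z ≠ 0) :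
    DifferentiableOn ℂ (berksonPorta τ G) disk :=
  ((differentiableOn_id.const_sub τ).pow 2).div (hG.const_mul τ) fun z hz =>
    mul_ne_zero (ne_zero_of_norm_eq_one hτ) (hG0 z hz)

theorem berksonPorta_ne_zero {τ : ℂ} (hτ : ‖τ‖ = 1) {G : ℂ → ℂ} {z : ℂ} (hz : z ∈ disk)
    (hG0 : G z ≠ 0) : berksonPorta τ G z ≠ 0 :=
  div_ne_zero (pow_ne_zero 2 (sub_ne_zero_of_mem_disk hτ hz))
    (mul_ne_zero (ne_zero_of_norm_eq_one hτ) hG0)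

namespace IsGenerator

variable {φ : ℝ → ℂ → ℂ} {G : ℂ → ℂ}

theorem eqOn_zero_of_isTrivial (hG : IsGenerator φ G) (hφ : IsSemigroup φ) (h : IsTrivial φ) :
    EqOn G 0 disk := by
  intro z hz
  have hderiv := hG.2 z hz 0 le_rfl
  rw [hφ.zero z hz] at hderiv
  have hconst : HasDerivWithinAt (fun s => φ s z) 0 (Ici 0) 0 := by
    refine (hasDerivWithinAt_const (0 : ℝ) (Ici 0) z).congr (fun s hs => ?_) (hφ.zero z hz)
    rcases (mem_Ici.mp hs).eq_or_lt with rfl | hs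
    · exact hφ.zero z hz
    · exact h s hs hz
  exact (uniqueDiffWithinAt_Ici (0 : ℝ)).eq_deriv _ hderiv hconst

theorem hasDerivWithinAt_re_cayley (hG : IsGenerator φ G) (hφ : IsSemigroup φ) {σ : ℂ}
    (hσ : ‖σ‖ = 1) {z : ℂ} (hz : z ∈ disk) {t : ℝ} (ht : 0 ≤ t) :
    HasDerivWithinAt (fun s => (cayley σ (φ s z)).re)
      (2 * σ * G (φ t z) / (σ - φ t z) ^ 2).re (Ici 0) t := by
  have hcayley := hasDerivAt_cayley (sub_ne_zero_of_mem_disk hσ (hφ.mapsTo t ht hz))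
  have h := Complex.reCLM.hasFDerivAt.comp_hasDerivWithinAt t
    (hcayley.comp_hasDerivWithinAt t (hG.2 z hz t ht))
  rwa [← mul_div_right_comm] at h

theorem re_berksonPorta_nonneg (hG : IsGenerator φ G) (hφ : IsSemigroup φ) {τ : ℂ}
    (hτ : ‖τ‖ = 1) (h : IsDWPoint φ τ) {z : ℂ} (hz : z ∈ disk) :
    0 ≤ (berksonPorta τ G z).re := by
  have hderiv := hG.hasDerivWithinAt_re_cayley hφ hτ hz le_rfl
  rw [hφ.zero z hz, hasDerivWithinAt_iff_tendsto_slope, Ici_sdiff_left] at hderiv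
  have hnonneg := ge_of_tendsto hderiv (eventually_mem_nhdsWithin.mono fun t (ht : 0 < t) => by
    rw [slope_def_field, sub_zero]
    refine div_nonneg (sub_nonneg.mpr ?_) ht.le
    rw [hφ.zero z hz]
    by_cases hid : EqOn (φ t) id disk
    · rw [hid hz, id]
    · exact (h.2 t ht hid).re_cayley_le hτ (hφ.holo t ht.le) (hφ.mapsTo t ht.le) hz)
  have heq : berksonPorta τ G z = 2 * (2 * τ * G z / (τ - z) ^ 2)⁻¹ := by
    rw [berksonPorta, inv_div]
    field_simp
  rw [heq]
  simpa using re_inv_nonneg hnonneg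

theorem re_cayley_lt (hG : IsGenerator φ G) (hφ : IsSemigroup φ) {τ : ℂ} (hτ : ‖τ‖ = 1)
    (hpos : ∀ z ∈ disk, 0 < (berksonPorta τ G z).re) {z : ℂ} (hz : z ∈ disk) {t : ℝ} (ht : 0 < t) :
    (cayley τ z).re < (cayley τ (φ t z)).re := by
  have hderiv := fun s hs => hG.hasDerivWithinAt_re_cayley hφ hτ hz (t := s) hs
  have hmono := strictMonoOn_of_hasDerivWithinAt_pos (convex_Ici (0 : ℝ))
    (fun s hs => (hderiv s hs).continuousWithinAt)
    (fun s hs => (hderiv s (interior_subset hs)).mono interior_subset) fun s hs => by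
      have hφs := hφ.mapsTo s (interior_subset hs) hz
      have heq : 2 * τ * G (φ s z) / (τ - φ s z) ^ 2 = 2 * (berksonPorta τ G (φ s z))⁻¹ := by
        rw [berksonPorta, inv_div]
        ring
      rw [heq]
      simpa using re_inv_pos (hpos _ hφs)
  have h := hmono self_mem_Ici ht.le ht
  simpa only [hφ.zero z hz] using h

theorem isDWPoint (hG : IsGenerator φ G) (hφ : IsSemigroup φ) {τ : ℂ} (hτ : ‖τ‖ = 1)
    (hpos : ∀ z ∈ disk, 0 < (berksonPorta τ G z).re) : IsDWPoint φ τ := by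
  refine ⟨fun htriv => ?_, fun t ht _ => isDWPointOfMap_of_re_cayley_lt hτ (hφ.holo t ht.le)
    (hφ.mapsTo t ht.le) fun z hz => hG.re_cayley_lt hφ hτ hpos hz ht⟩
  have h := hG.re_cayley_lt hφ hτ hpos zero_mem_disk one_pos
  rw [htriv 1 one_pos zero_mem_disk] at h
  exact h.false

end IsGenerator

namespace IsHerglotz

variable {h : ℂ → ℂ}

theorem ne_zero (hh : IsHerglotz h) (hne : ¬ EqOn h 0 disk) {z : ℂ} (hz : z ∈ disk) : h z ≠ 0 :=
  fun h0 => hne fun w hw => by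
    simpa [h0] using hh.eq_of_re_eq_zero hz hw (by simp [h0])

theorem inv (hh : IsHerglotz h) (hne : ¬ EqOn h 0 disk) : IsHerglotz fun z => (h z)⁻¹ :=
  ⟨hh.differentiableOn.inv fun _ hz => hh.ne_zero hne hz,
    fun z hz => re_inv_nonneg (hh.re_nonneg z hz)⟩

end IsHerglotz

theorem isHerglotz_berksonPorta {τ : ℂ} (hτ : ‖τ‖ = 1) {G : ℂ → ℂ}
    (hG : DifferentiableOn ℂ G disk) (hne : ¬ EqOn G 0 disk)
    (hre : ∀ z ∈ disk, 0 ≤ (berksonPorta τ G z).re) :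
    (∀ z ∈ disk, G z ≠ 0) ∧ IsHerglotz (berksonPorta τ G) := by
  have hzero : ∀ z ∈ disk, (berksonPorta τ G z)⁻¹ = 0 → G z = 0 := fun z hz h0 => by
    by_contra hG0
    exact berksonPorta_ne_zero hτ hz hG0 (inv_eq_zero.mp h0)
  have hinv : IsHerglotz fun z => (berksonPorta τ G z)⁻¹ := by
    refine ⟨?_, fun z hz => re_inv_nonneg (hre z hz)⟩
    simp only [berksonPorta, inv_div]
    exact (hG.const_mul τ).div ((differentiableOn_id.const_sub τ).pow 2)
      fun z hz => pow_ne_zero 2 (sub_ne_zero_of_mem_disk hτ hz)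
  have hne' : ¬ EqOn (fun z => (berksonPorta τ G z)⁻¹) 0 disk :=
    fun h0 => hne fun z hz => hzero z hz (h0 hz)
  refine ⟨fun z hz h0 => hinv.ne_zero hne' hz (by simp [berksonPorta, h0]), ?_⟩
  simpa only [inv_inv] using hinv.inv hne'

/-! ### Boundary regular fixed points and spectral values -/

theorem re_sq_div_le {v h : ℂ} {α : ℝ} (hα : 0 < α) (hv : 0 < v.re) (hle : α * v.re ≤ h.re) :
    (v ^ 2 / h).re ≤ v.re / α := by
  have hh : 0 < Complex.normSq h :=
    Complex.normSq_pos.mpr fun h0 => by simp [h0] at hle; nlinarith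
  have hid : v.re * Complex.normSq h - α * (v ^ 2 * conj h).re =
      α * Complex.normSq v * (h.re - α * v.re) + Complex.normSq (h - α * v) * v.re := by
    simp only [Complex.normSq_apply, pow_two, Complex.mul_re, Complex.mul_im, Complex.conj_re,
      Complex.conj_im, Complex.sub_re, Complex.sub_im, Complex.ofReal_re, Complex.ofReal_im]
    ring
  have hdiff := sub_nonneg.mpr hle
  have hnonneg : 0 ≤
      α * Complex.normSq v * (h.re - α * v.re) + Complex.normSq (h - α * v) * v.re :=
    add_nonneg (mul_nonneg (mul_nonneg hα.le (Complex.normSq_nonneg v)) hdiff)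
      (mul_nonneg (Complex.normSq_nonneg _) hv.le)
  have heq : (v ^ 2 / h).re = (v ^ 2 * conj h).re / Complex.normSq h := by
    rw [div_eq_mul_inv, Complex.inv_def, ← mul_assoc, Complex.re_mul_ofReal, div_eq_mul_inv]
  rw [heq, div_le_div_iff₀ hh hα]
  linarith

theorem re_cayley_eq_zero {σ τ : ℂ} (hσ : ‖σ‖ = 1) (hτ : ‖τ‖ = 1) : (cayley σ τ).re = 0 := by
  simp [re_cayley hσ, hτ]

theorem two_mul_div_sub_sq_eq {τ σ : ℂ} (hτ : ‖τ‖ = 1) (hσ : ‖σ‖ = 1) (hne : τ ≠ σ) (G : ℂ → ℂ)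
    {z : ℂ} (hz : z ∈ disk) :
    2 * σ * G z / (σ - z) ^ 2 =
      -(‖τ - σ‖ ^ 2 / 2 : ℝ) * ((cayley σ z - cayley σ τ) ^ 2 / berksonPorta τ G z) := by
  have hτ0 := ne_zero_of_norm_eq_one hτ
  have hσ0 := ne_zero_of_norm_eq_one hσ
  have hτz := sub_ne_zero_of_mem_disk hτ hz
  have hσz := sub_ne_zero_of_mem_disk hσ hz
  have hστ : σ - τ ≠ 0 := sub_ne_zero.mpr hne.symm
  have hD : ((‖τ - σ‖ ^ 2 : ℝ) : ℂ) = -(τ - σ) ^ 2 / (τ * σ) :=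
    eq_div_of_mul_eq (mul_ne_zero hτ0 hσ0) (norm_sub_sq_mul_mul hτ hσ)
  have hcayley : cayley σ z - cayley σ τ = -(2 * σ * (τ - z)) / ((σ - z) * (σ - τ)) := by
    rw [cayley, cayley]
    field_simp
    ring
  rw [Complex.ofReal_div, hD, hcayley, berksonPorta, div_div_eq_mul_div]
  push_cast
  field_simp
  ring

theorem neg_mul_re_cayley_le {τ σ : ℂ} (hτ : ‖τ‖ = 1) (hσ : ‖σ‖ = 1) (hne : τ ≠ σ) {G : ℂ → ℂ}
    {α : ℝ} (hα : 0 < α) {z : ℂ} (hz : z ∈ disk)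
    (hle : α * (cayley σ z).re ≤ (berksonPorta τ G z).re) :
    -(‖τ - σ‖ ^ 2 / (2 * α)) * (cayley σ z).re ≤ (2 * σ * G z / (σ - z) ^ 2).re := by
  have hv : (cayley σ z - cayley σ τ).re = (cayley σ z).re := by
    rw [Complex.sub_re, re_cayley_eq_zero hσ hτ, sub_zero]
  have hest := re_sq_div_le hα (hv.symm ▸ re_cayley_pos hσ hz) (hv.symm ▸ hle)
  rw [two_mul_div_sub_sq_eq hτ hσ hne G hz, ← Complex.ofReal_neg, Complex.re_ofReal_mul]
  calc -(‖τ - σ‖ ^ 2 / (2 * α)) * (cayley σ z).re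
      = -(‖τ - σ‖ ^ 2 / 2) * ((cayley σ z - cayley σ τ).re / α) := by rw [hv]; field_simp
    _ ≤ _ := mul_le_mul_of_nonpos_left hest (neg_nonpos.mpr (by positivity))

namespace IsGenerator

variable {φ : ℝ → ℂ → ℂ} {G : ℂ → ℂ}

theorem exp_mul_re_cayley_le (hG : IsGenerator φ G) (hφ : IsSemigroup φ) {τ σ : ℂ} (hτ : ‖τ‖ = 1)
    (hσ : ‖σ‖ = 1) (hne : τ ≠ σ) {α : ℝ} (hα : 0 < α)
    (hle : ∀ z ∈ disk, α * (cayley σ z).re ≤ (berksonPorta τ G z).re) {z : ℂ} (hz : z ∈ disk)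
    {t : ℝ} (ht : 0 ≤ t) :
    Real.exp (-(‖τ - σ‖ ^ 2 / (2 * α) * t)) * (cayley σ z).re ≤ (cayley σ (φ t z)).re := by
  set c := ‖τ - σ‖ ^ 2 / (2 * α)
  have hderiv : ∀ s ∈ Ici (0 : ℝ),
      HasDerivWithinAt (fun s => Real.exp (c * s) * (cayley σ (φ s z)).re) _ (Ici 0) s :=
    fun s hs => ((((hasDerivAt_id' s).const_mul c).exp).hasDerivWithinAt).mul
      (hG.hasDerivWithinAt_re_cayley hφ hσ hz hs)
  have hmono := monotoneOn_of_hasDerivWithinAt_nonneg (convex_Ici (0 : ℝ))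
    (fun s hs => (hderiv s hs).continuousWithinAt)
    (fun s hs => (hderiv s (interior_subset hs)).mono interior_subset) fun s hs => by
      have hφs := hφ.mapsTo s (interior_subset hs) hz
      have h : -c * (cayley σ (φ s z)).re ≤ (2 * σ * G (φ s z) / (σ - φ s z) ^ 2).re :=
        neg_mul_re_cayley_le hτ hσ hne hα hφs (hle _ hφs)
      nlinarith [Real.exp_pos (c * s)]
  have h := hmono self_mem_Ici ht ht
  simp only [mul_zero, Real.exp_zero, one_mul, hφ.zero z hz] at h
  rwa [Real.exp_neg, inv_mul_le_iff₀ (Real.exp_pos _)]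

theorem isSemigroupBRFP (hG : IsGenerator φ G) (hφ : IsSemigroup φ) {τ σ : ℂ} (hτ : ‖τ‖ = 1)
    (hσ : ‖σ‖ = 1) (hne : τ ≠ σ) {α : ℝ} (hα : 0 < α)
    (hle : ∀ z ∈ disk, α * (cayley σ z).re ≤ (berksonPorta τ G z).re) : IsSemigroupBRFP φ σ :=
  fun t ht => isBRFP_of_mul_re_cayley_le hσ (hφ.holo t ht) (hφ.mapsTo t ht) (Real.exp_pos _)
    fun _ hz => hG.exp_mul_re_cayley_le hφ hτ hσ hne hα hle hz ht

end IsGenerator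

theorem hasAngularLimit_sub_sq_div (τ σ : ℂ) :
    HasAngularLimit (fun z => (τ - z) ^ 2 / τ) σ ((τ - σ) ^ 2 / τ) :=
  HasAngularLimit.of_continuousAt (f := fun z => (τ - z) ^ 2 / τ) (by fun_prop)

theorem HasSpectralValue.two_mul_mul_eq {τ σ : ℂ} {G : ℂ → ℂ} {l m : ℝ}
    (hl : HasSpectralValue G σ l) (hτ : ‖τ‖ = 1) (hσ : ‖σ‖ = 1) (hG0 : ∀ z ∈ disk, G z ≠ 0)
    (hm : HasPointMass (berksonPorta τ G) σ m) : 2 * m * l = -‖τ - σ‖ ^ 2 := by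
  have hτ0 := ne_zero_of_norm_eq_one hτ
  have hσ0 := ne_zero_of_norm_eq_one hσ
  have hprod : HasAngularLimit (fun z => (τ - z) ^ 2 / τ) σ (2 * σ * m * l) :=
    (HasAngularLimit.mul hm hl).congr fun z hz => by
      have hσz := sub_ne_zero_of_mem_disk hσ hz
      have hGz := hG0 z hz
      simp only [berksonPorta]
      field_simp
  have heq := hprod.unique hσ (hasAngularLimit_sub_sq_div τ σ)
  rw [eq_div_iff hτ0] at heq
  have hcast : ((2 * m * l : ℝ) : ℂ) = ((-‖τ - σ‖ ^ 2 : ℝ) : ℂ) := by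
    refine mul_right_cancel₀ (mul_ne_zero hτ0 hσ0) ?_
    rw [Complex.ofReal_neg, neg_mul, norm_sub_sq_mul_mul hτ hσ, neg_neg]
    push_cast
    linear_combination heq
  exact_mod_cast hcast

theorem HasPointMass.hasSpectralValue {τ σ : ℂ} {G : ℂ → ℂ} {m : ℝ}
    (hm : HasPointMass (berksonPorta τ G) σ m) (hm0 : m ≠ 0) (hτ : ‖τ‖ = 1) (hσ : ‖σ‖ = 1) :
    HasSpectralValue G σ (-‖τ - σ‖ ^ 2 / (2 * m)) := by
  have hτ0 := ne_zero_of_norm_eq_one hτ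
  have hσ0 := ne_zero_of_norm_eq_one hσ
  have hm0' : (m : ℂ) ≠ 0 := Complex.ofReal_ne_zero.mpr hm0
  have hlim := (hasAngularLimit_sub_sq_div τ σ).mul
    (HasAngularLimit.inv hm (mul_ne_zero (mul_ne_zero two_ne_zero hσ0) hm0'))
  have hval : (τ - σ) ^ 2 / τ * (2 * σ * (m : ℂ))⁻¹ = ((-‖τ - σ‖ ^ 2 / (2 * m) : ℝ) : ℂ) := by
    rw [← neg_neg ((τ - σ) ^ 2), ← norm_sub_sq_mul_mul hτ hσ]
    push_cast
    field_simp
  rw [hval] at hlim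
  refine hlim.congr fun z hz => ?_
  have hτz := sub_ne_zero_of_mem_disk hτ hz
  have hσz := sub_ne_zero_of_mem_disk hσ hz
  simp only [berksonPorta]
  field_simp

/-! ### The class `Gen τ σ lam` -/

section Gen

variable {n : ℕ} {τ : ℂ} {σ : Fin n → ℂ} {lam : Fin n → ℝ} {G q : ℂ → ℂ} {k : Fin n} {l m : ℝ}

theorem alpha_pos (hne : τ ≠ σ k) (hlam : lam k < 0) : 0 < alpha τ σ lam k :=
  div_pos (pow_pos (norm_pos_iff.mpr (sub_ne_zero.mpr hne)) 2) (by simpa using hlam.ne)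

theorem sum_alpha_pos [NeZero n] (hτσ : ∀ k, τ ≠ σ k) (hlam : ∀ k, lam k < 0) :
    0 < ∑ k, alpha τ σ lam k :=
  Finset.sum_pos (fun k _ => alpha_pos (hτσ k) (hlam k)) Finset.univ_nonempty

theorem alpha_le_iff (hlam : lam k < 0) (hm : 0 < m) (hml : 2 * m * l = -‖τ - σ k‖ ^ 2) :
    alpha τ σ lam k ≤ m ↔ lam k ≤ l := by
  have hprod : alpha τ σ lam k * lam k = m * l := by
    have hlam' := hlam.ne
    rw [alpha, abs_of_neg hlam]
    field_simp
    linarith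
  rw [← mul_le_mul_right_of_neg hlam, hprod, mul_le_mul_iff_of_pos_left hm]

theorem pZero_zero (hσ : ∀ k, ‖σ k‖ = 1) :
    pZero τ σ lam 0 = ∑ k, (alpha τ σ lam k : ℂ) :=
  Finset.sum_congr rfl fun k _ => by rw [← cayley, cayley_zero (hσ k), mul_one]

theorem re_pZero (z : ℂ) :
    (pZero τ σ lam z).re = ∑ k, alpha τ σ lam k * (cayley (σ k) z).re := by
  rw [pZero, Complex.re_sum]
  exact Finset.sum_congr rfl fun k _ => Complex.re_ofReal_mul _ _

theorem alpha_mul_re_cayley_le_re_pZero (hσ : ∀ k, ‖σ k‖ = 1) (hτσ : ∀ k, τ ≠ σ k)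
    (hlam : ∀ k, lam k < 0) (k : Fin n) {z : ℂ} (hz : z ∈ disk) :
    alpha τ σ lam k * (cayley (σ k) z).re ≤ (pZero τ σ lam z).re := by
  rw [re_pZero]
  exact Finset.single_le_sum (f := fun k => alpha τ σ lam k * (cayley (σ k) z).re)
    (fun k _ => mul_nonneg (alpha_pos (hτσ k) (hlam k)).le (re_cayley_pos (hσ k) hz).le)
    (Finset.mem_univ k)

theorem differentiableOn_pZero (hσ : ∀ k, ‖σ k‖ = 1) :
    DifferentiableOn ℂ (pZero τ σ lam) disk :=
  .fun_sum fun k _ => (differentiableOn_cayley (hσ k)).const_mul _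

theorem continuousAt_pZero (hτσ : ∀ k, τ ≠ σ k) : ContinuousAt (pZero τ σ lam) τ :=
  tendsto_finsetSum _ fun k _ => (continuousAt_cayley (hτσ k).symm).tendsto.const_mul _

/-- What remains of the Herglotz function of `G` when point masses `alpha τ σ lam k` at the points
`σ k` are split off. -/
noncomputable def remainder (τ : ℂ) (σ : Fin n → ℂ) (lam : Fin n → ℝ) (G : ℂ → ℂ) (z : ℂ) : ℂ :=
  berksonPorta τ G z - pZero τ σ lam z

/-- The vector field with remainder `q`, see `remainder_ofRemainder`. -/
noncomputable def ofRemainder (τ : ℂ) (σ : Fin n → ℂ) (lam : Fin n → ℝ) (q : ℂ → ℂ) : ℂ → ℂ :=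
  berksonPorta τ fun z => pZero τ σ lam z + q z

theorem remainder_ofRemainder (hτ : ‖τ‖ = 1) (q : ℂ → ℂ) :
    EqOn (remainder τ σ lam (ofRemainder τ σ lam q)) q disk := fun z hz => by
  rw [remainder, ofRemainder, berksonPorta_berksonPorta hτ _ hz, add_sub_cancel_left]

theorem eqOn_ofRemainder (hτ : ‖τ‖ = 1) (h : EqOn (remainder τ σ lam G) q disk) :
    EqOn G (ofRemainder τ σ lam q) disk := fun z hz => by
  rw [ofRemainder, berksonPorta, ← h hz, remainder, add_sub_cancel, ← berksonPorta,
    berksonPorta_berksonPorta hτ G hz]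

theorem remainder_zero (hτ : ‖τ‖ = 1) (hσ : ∀ k, ‖σ k‖ = 1) (G : ℂ → ℂ) :
    remainder τ σ lam G 0 = ell τ σ lam (G 0) := by
  rw [remainder, ell, pZero_zero hσ, berksonPorta, sub_zero, pow_two,
    mul_div_mul_left _ _ (ne_zero_of_norm_eq_one hτ)]

theorem ell_injective (hτ : τ ≠ 0) : Function.Injective (ell τ σ lam) := fun ζ ξ h => by
  have hdiv : τ / ζ = τ / ξ := sub_left_injective h
  rw [div_eq_mul_inv, div_eq_mul_inv] at hdiv
  exact inv_injective (mul_left_cancel₀ hτ hdiv)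

theorem ofRemainder_zero (hτ : ‖τ‖ = 1) (hσ : ∀ k, ‖σ k‖ = 1) {ζ : ℂ}
    (hq : q 0 = ell τ σ lam ζ) : ofRemainder τ σ lam q 0 = ζ :=
  ell_injective (σ := σ) (lam := lam) (ne_zero_of_norm_eq_one hτ) <| by
    rw [← remainder_zero hτ hσ, remainder_ofRemainder hτ q zero_mem_disk, hq]

theorem isHerglotz_berksonPorta_of_mem_gen (hτ : ‖τ‖ = 1) (hG : G ∈ Gen τ σ lam)
    (hne : ¬ EqOn G 0 disk) : (∀ z ∈ disk, G z ≠ 0) ∧ IsHerglotz (berksonPorta τ G) := by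
  obtain ⟨φ, hφ, hφG, htriv | hDW, -⟩ := hG
  · exact absurd (hφG.eqOn_zero_of_isTrivial hφ htriv) hne
  · exact isHerglotz_berksonPorta hτ hφG.1 hne fun z hz =>
      hφG.re_berksonPorta_nonneg hφ hτ hDW hz

theorem alpha_le_of_hasSpectralValue (hτ : ‖τ‖ = 1) (hσ : ‖σ k‖ = 1) (hne : τ ≠ σ k)
    (hlam : lam k < 0) (hG0 : ∀ z ∈ disk, G z ≠ 0) (hh : IsHerglotz (berksonPorta τ G))
    (hm : HasPointMass (berksonPorta τ G) (σ k) m) (hl : HasSpectralValue G (σ k) l)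
    (hle : lam k ≤ l) : alpha τ σ lam k ≤ m := by
  have hml := hl.two_mul_mul_eq hτ hσ hG0 hm
  have hm0 : m ≠ 0 := by
    rintro rfl
    simp [sub_eq_zero, hne] at hml
  exact (alpha_le_iff hlam ((hh.hasPointMass_nonneg hσ hm).lt_of_ne' hm0) hml).mpr hle

theorem isHerglotz_remainder (hτ : ‖τ‖ = 1) (hσ : ∀ k, ‖σ k‖ = 1)
    (hσinj : Function.Injective σ) (hτσ : ∀ k, τ ≠ σ k) (hlam : ∀ k, lam k < 0)
    (hG : G ∈ Gen τ σ lam) (hne : ¬ EqOn G 0 disk) : IsHerglotz (remainder τ σ lam G) := by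
  obtain ⟨hG0, hh⟩ := isHerglotz_berksonPorta_of_mem_gen hτ hG hne
  obtain ⟨φ, -, -, -, hspec⟩ := hG
  choose m hm using fun k => hh.exists_hasPointMass (hσ k)
  choose l hl using fun k => (hspec k).2
  exact hh.sub_sum_mul_cayley_of_le (s := Finset.univ) (fun k _ => hσ k) hσinj.injOn
    (fun k _ => (hm k).2) fun k _ =>
      alpha_le_of_hasSpectralValue hτ (hσ k) (hτσ k) (hlam k) hG0 hh (hm k).2 (hl k).1 (hl k).2.1

theorem mem_gen_of_alpha_mul_re_cayley_le [NeZero n] (hτ : ‖τ‖ = 1) (hσ : ∀ k, ‖σ k‖ = 1)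
    (hτσ : ∀ k, τ ≠ σ k) (hlam : ∀ k, lam k < 0) (hh : IsHerglotz (berksonPorta τ G))
    (hle : ∀ k, ∀ z ∈ disk, alpha τ σ lam k * (cayley (σ k) z).re ≤ (berksonPorta τ G z).re) :
    G ∈ Gen τ σ lam := by
  have hα := fun k => alpha_pos (hτσ k) (hlam k)
  have hpos : ∀ z ∈ disk, 0 < (berksonPorta τ G z).re := fun z hz =>
    (mul_pos (hα 0) (re_cayley_pos (hσ 0) hz)).trans_le (hle 0 z hz)
  have hpos' : ∀ z ∈ disk, 0 < (τ * G z / (τ - z) ^ 2).re := fun z hz => by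
    simpa only [berksonPorta, inv_div] using re_inv_pos (hpos z hz)
  have hG : DifferentiableOn ℂ G disk :=
    (differentiableOn_berksonPorta hτ hh.differentiableOn fun z hz h0 => by
      simpa [h0] using hpos z hz).congr fun z hz => (berksonPorta_berksonPorta hτ G hz).symm
  obtain ⟨φ, hφ, hφG⟩ := exists_isSemigroup_isGenerator hτ hG hpos'
  refine ⟨φ, hφ, hφG, .inr (hφG.isDWPoint hφ hτ hpos), fun k =>
    ⟨hφG.isSemigroupBRFP hφ hτ (hσ k) (hτσ k) (hα k) (hle k), ?_⟩⟩
  obtain ⟨m, hgreatest, hm⟩ := hh.exists_hasPointMass (hσ k)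
  have hαm : alpha τ σ lam k ≤ m := hgreatest.2 (hle k)
  have hm0 : 0 < m := (hα k).trans_le hαm
  refine ⟨_, hm.hasSpectralValue hm0.ne' hτ (hσ k),
    (alpha_le_iff (hlam k) hm0 (mul_div_cancel₀ _ (by positivity))).mp hαm,
    div_nonpos_of_nonpos_of_nonneg (neg_nonpos.mpr (by positivity)) (by positivity)⟩

theorem mem_gen_of_isHerglotz_remainder [NeZero n] (hτ : ‖τ‖ = 1) (hσ : ∀ k, ‖σ k‖ = 1)
    (hτσ : ∀ k, τ ≠ σ k) (hlam : ∀ k, lam k < 0) (hq : IsHerglotz (remainder τ σ lam G)) :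
    G ∈ Gen τ σ lam := by
  have hdecomp : berksonPorta τ G = fun z => pZero τ σ lam z + remainder τ σ lam G z :=
    funext fun z => (add_sub_cancel _ _).symm
  have hle : ∀ k, ∀ z ∈ disk,
      alpha τ σ lam k * (cayley (σ k) z).re ≤ (berksonPorta τ G z).re := fun k z hz => by
    rw [hdecomp, Complex.add_re]
    exact (alpha_mul_re_cayley_le_re_pZero hσ hτσ hlam k hz).trans
      (le_add_of_nonneg_right (hq.re_nonneg z hz))
  refine mem_gen_of_alpha_mul_re_cayley_le hτ hσ hτσ hlam ⟨?_, fun z hz => ?_⟩ hle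
  · rw [hdecomp]
    exact (differentiableOn_pZero hσ).add hq.differentiableOn
  · exact (mul_nonneg (alpha_pos (hτσ 0) (hlam 0)).le (re_cayley_pos (hσ 0) hz).le).trans
      (hle 0 z hz)

theorem hasBeta_iff_hasPointMass_berksonPorta (hτ : ‖τ‖ = 1) :
    HasBeta τ G (2 * m) ↔ HasPointMass (berksonPorta τ G) τ m := by
  have hτ0 := ne_zero_of_norm_eq_one hτ
  have hfun : ∀ z, (τ - z) * berksonPorta τ G z = τ * ((τ - z) ^ 3 / (τ ^ 2 * G z)) := fun z => by
    rw [berksonPorta, mul_div_assoc', mul_div_assoc', pow_two τ, mul_assoc,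
      mul_div_mul_left _ _ hτ0, ← pow_succ']
  have hval : 2 * τ * (m : ℂ) = τ * ((2 * m : ℝ) : ℂ) := by
    push_cast
    ring
  simp only [HasBeta, HasPointMass, hfun, hval]
  refine ⟨.const_mul τ, fun h => ?_⟩
  simpa only [inv_mul_cancel_left₀ hτ0] using h.const_mul τ⁻¹

theorem hasBeta_iff_hasPointMass_remainder (hτ : ‖τ‖ = 1) (hτσ : ∀ k, τ ≠ σ k) :
    HasBeta τ G (2 * m) ↔ HasPointMass (remainder τ σ lam G) τ m := by
  have hzero : HasPointMass (pZero τ σ lam) τ 0 := .of_continuousAt (continuousAt_pZero hτσ)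
  rw [hasBeta_iff_hasPointMass_berksonPorta hτ]
  refine ⟨fun h => sub_zero m ▸ h.sub hzero, fun h => ?_⟩
  simpa only [remainder, sub_add_cancel, add_zero] using h.add hzero

theorem existsUnique_hasBeta (hτ : ‖τ‖ = 1) (hτσ : ∀ k, τ ≠ σ k)
    (hq : IsHerglotz (remainder τ σ lam G)) : ∃! b : ℝ, HasBeta τ G b := by
  obtain ⟨m, -, hm⟩ := hq.exists_hasPointMass hτ
  refine ⟨2 * m, (hasBeta_iff_hasPointMass_remainder hτ hτσ).mpr hm, fun b hb => ?_⟩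
  exact_mod_cast HasAngularLimit.unique hτ hb ((hasBeta_iff_hasPointMass_remainder hτ hτσ).mpr hm)

/-! ### The value region -/

theorem norm_div_sub_one_le_one_iff {a : ℝ} (ha : 0 < a) {w : ℂ} (hw : w ≠ 0) :
    ‖2 * a / w - 1‖ ≤ 1 ↔ a ≤ w.re := by
  have hdiff : Complex.normSq w - Complex.normSq (2 * a - w) = 4 * a * (w.re - a) := by
    simp [Complex.normSq_apply]
    ring
  rw [div_sub_one hw, norm_div, div_le_one (norm_pos_iff.mpr hw),
    ← sq_le_sq₀ (norm_nonneg _) (norm_nonneg _), Complex.sq_norm, Complex.sq_norm, ← sub_nonneg,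
    hdiff, mul_nonneg_iff_of_pos_left (by positivity), sub_nonneg]

theorem mem_diskZ_iff (hτ : τ ≠ 0) (hα : 0 < ∑ k, alpha τ σ lam k) {ζ : ℂ} (hζ : ζ ≠ 0) :
    ζ ∈ diskZ τ σ lam ↔ 0 ≤ (ell τ σ lam ζ).re := by
  have hquot : 2 * τ⁻¹ * (∑ k, alpha τ σ lam k : ℝ) * ζ =
      2 * (∑ k, alpha τ σ lam k : ℝ) / (τ / ζ) := by
    field_simp
  rw [ell, ← Complex.ofReal_sum, Complex.sub_re, Complex.ofReal_re, sub_nonneg,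
    ← norm_div_sub_one_le_one_iff hα (div_ne_zero hτ hζ), ← hquot, Complex.ofReal_sum]
  rfl

theorem exists_isHerglotz_hasPointMass_iff (hτ : ‖τ‖ = 1) {w : ℂ} :
    (∃ q, IsHerglotz q ∧ q 0 = w ∧ HasPointMass q τ m) ↔ 0 ≤ m ∧ m ≤ w.re := by
  constructor
  · rintro ⟨q, hq, rfl, hm⟩
    exact ⟨hq.hasPointMass_nonneg hτ hm, hq.hasPointMass_le_re_zero hτ hm⟩
  · rintro ⟨hm0, hmw⟩
    refine ⟨fun z => m * cayley τ z + (w - m),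
      ((isHerglotz_cayley hτ).const_mul hm0).add (.const (by simpa using hmw)),
      by simp [cayley_zero hτ], ?_⟩
    simpa using ((hasPointMass_cayley hτ).const_mul m).add
      (.of_continuousAt (continuousAt_const (y := w - m)))

theorem mem_valueRegion_iff [NeZero n] (hτ : ‖τ‖ = 1) (hσ : ∀ k, ‖σ k‖ = 1)
    (hσinj : Function.Injective σ) (hτσ : ∀ k, τ ≠ σ k) (hlam : ∀ k, lam k < 0) {ζ : ℂ} :
    (ζ, 2 * m) ∈ valueRegion τ σ lam ↔
      ζ ≠ 0 ∧ ∃ q, IsHerglotz q ∧ q 0 = ell τ σ lam ζ ∧ HasPointMass q τ m := by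
  constructor
  · rintro ⟨G, hG, hne, rfl, hβ⟩
    exact ⟨(isHerglotz_berksonPorta_of_mem_gen hτ hG hne).1 0 zero_mem_disk, remainder τ σ lam G,
      isHerglotz_remainder hτ hσ hσinj hτσ hlam hG hne, remainder_zero hτ hσ G,
      (hasBeta_iff_hasPointMass_remainder hτ hτσ).mp hβ⟩
  · rintro ⟨hζ, q, hq, hq0, hm⟩
    have hrem : EqOn q (remainder τ σ lam (ofRemainder τ σ lam q)) disk :=
      (remainder_ofRemainder hτ q).symm
    have hzero := ofRemainder_zero hτ hσ hq0
    refine ⟨ofRemainder τ σ lam q,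
      mem_gen_of_isHerglotz_remainder hτ hσ hτσ hlam (hq.congr hrem),
      fun h => hζ (hzero.symm.trans (h zero_mem_disk)), hzero,
      (hasBeta_iff_hasPointMass_remainder hτ hτσ).mpr (hm.congr hrem)⟩

theorem valueRegion_eq [NeZero n] (hτ : ‖τ‖ = 1) (hσ : ∀ k, ‖σ k‖ = 1)
    (hσinj : Function.Injective σ) (hτσ : ∀ k, τ ≠ σ k) (hlam : ∀ k, lam k < 0) :
    valueRegion τ σ lam =
      {p : ℂ × ℝ | p.1 ∈ diskZ τ σ lam \ {0} ∧ 0 ≤ p.2 ∧ p.2 ≤ 2 * (ell τ σ lam p.1).re} := by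
  ext ⟨ζ, b⟩
  obtain ⟨m, rfl⟩ : ∃ m, b = 2 * m := ⟨b / 2, (mul_div_cancel₀ b two_ne_zero).symm⟩
  rw [mem_valueRegion_iff hτ hσ hσinj hτσ hlam, exists_isHerglotz_hasPointMass_iff hτ]
  simp only [mem_ofPred_eq, Set.mem_sdiff, mem_singleton_iff, two_pos, mul_nonneg_iff_of_pos_left,
    mul_le_mul_iff_right₀]
  constructor
  · rintro ⟨hζ, hm0, hmle⟩
    exact ⟨⟨(mem_diskZ_iff (ne_zero_of_norm_eq_one hτ) (sum_alpha_pos hτσ hlam) hζ).mpr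
      (hm0.trans hmle), hζ⟩, hm0, hmle⟩
  · rintro ⟨⟨-, hζ⟩, hm⟩
    exact ⟨hζ, hm⟩

/-! ### The extremal vector fields -/

theorem extremalG_eq_ofRemainder (hτ : ‖τ‖ = 1) (ζ : ℂ) :
    extremalG τ σ lam ζ = ofRemainder τ σ lam fun z =>
      (ell τ σ lam ζ).re * cayley τ z + (ell τ σ lam ζ).im * Complex.I := by
  funext z
  have hconj : τ * conj τ = 1 := by simp [Complex.mul_conj', hτ]
  have hfactor : (τ - z) ^ 2 = τ * ((τ - z) * (1 - conj τ * z)) := by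
    linear_combination (τ - z) * z * hconj
  rw [ofRemainder, berksonPorta, hfactor, mul_div_mul_left _ _ (ne_zero_of_norm_eq_one hτ),
    extremalG, cayley]
  ring_nf

theorem isHerglotz_remainder_extremalG (hτ : ‖τ‖ = 1) {ζ : ℂ} (hζ : 0 ≤ (ell τ σ lam ζ).re) :
    IsHerglotz (remainder τ σ lam (extremalG τ σ lam ζ)) := by
  rw [extremalG_eq_ofRemainder hτ]
  exact (((isHerglotz_cayley hτ).const_mul hζ).add (.const (by simp))).congr
    (remainder_ofRemainder hτ _).symm

theorem extremalG_zero (hτ : ‖τ‖ = 1) (hσ : ∀ k, ‖σ k‖ = 1) (ζ : ℂ) :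
    extremalG τ σ lam ζ 0 = ζ := by
  rw [extremalG_eq_ofRemainder hτ]
  exact ofRemainder_zero hτ hσ (by simp [cayley_zero hτ])

theorem hasBeta_extremalG (hτ : ‖τ‖ = 1) (hτσ : ∀ k, τ ≠ σ k) (ζ : ℂ) :
    HasBeta τ (extremalG τ σ lam ζ) (2 * (ell τ σ lam ζ).re) := by
  rw [hasBeta_iff_hasPointMass_remainder (σ := σ) (lam := lam) hτ hτσ,
    extremalG_eq_ofRemainder hτ]
  refine HasPointMass.congr ?_ (remainder_ofRemainder hτ _).symm
  simpa using ((hasPointMass_cayley hτ).const_mul (ell τ σ lam ζ).re).add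
    (.of_continuousAt (continuousAt_const (y := (ell τ σ lam ζ).im * Complex.I)))

theorem eqOn_extremalG (hτ : ‖τ‖ = 1) (hσ : ∀ k, ‖σ k‖ = 1) (hτσ : ∀ k, τ ≠ σ k)
    (hq : IsHerglotz (remainder τ σ lam G)) (hβ : HasBeta τ G (2 * (ell τ σ lam (G 0)).re)) :
    EqOn G (extremalG τ σ lam (G 0)) disk := by
  have hm := (hasBeta_iff_hasPointMass_remainder (lam := lam) hτ hτσ).mp hβ
  rw [← remainder_zero hτ hσ] at hm
  have hrem := hq.eqOn_of_hasPointMass_re_zero hτ hm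
  rw [remainder_zero hτ hσ] at hrem
  rw [extremalG_eq_ofRemainder hτ]
  exact eqOn_ofRemainder hτ hrem

end Gen

end DiskSemigroup

theorem mainTheorem6 (n : ℕ) (hn : 1 ≤ n) (τ : ℂ) (σ : Fin n → ℂ) (lam : Fin n → ℝ)
    (hτ : ‖τ‖ = 1) (hσ : ∀ k, ‖σ k‖ = 1) (hσinj : Function.Injective σ)
    (hτσ : ∀ k, τ ≠ σ k) (hlam : ∀ k, lam k < 0) :
    (∀ G ∈ Gen τ σ lam, ¬ EqOn G 0 disk → ∃! b : ℝ, HasBeta τ G b) ∧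
    valueRegion τ σ lam =
      {p : ℂ × ℝ | p.1 ∈ diskZ τ σ lam \ {0} ∧ 0 ≤ p.2 ∧ p.2 ≤ 2 * (ell τ σ lam p.1).re} ∧
    ∀ ζ ∈ diskZ τ σ lam \ {0},
      (extremalG τ σ lam ζ ∈ Gen τ σ lam ∧ extremalG τ σ lam ζ 0 = ζ ∧
        HasBeta τ (extremalG τ σ lam ζ) (2 * (ell τ σ lam ζ).re)) ∧
      ∀ G ∈ Gen τ σ lam, G 0 = ζ → HasBeta τ G (2 * (ell τ σ lam ζ).re) →
        EqOn G (extremalG τ σ lam ζ) disk := by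
  have : NeZero n := ⟨Nat.one_le_iff_ne_zero.mp hn⟩
  have hherglotz : ∀ G ∈ Gen τ σ lam, ¬ EqOn G 0 disk → IsHerglotz (remainder τ σ lam G) :=
    fun G hG hne => isHerglotz_remainder hτ hσ hσinj hτσ hlam hG hne
  refine ⟨fun G hG hne => existsUnique_hasBeta hτ hτσ (hherglotz G hG hne),
    valueRegion_eq hτ hσ hσinj hτσ hlam, fun ζ ⟨hζZ, hζ0⟩ => ⟨⟨?_, extremalG_zero hτ hσ ζ,
      hasBeta_extremalG hτ hτσ ζ⟩, ?_⟩⟩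
  · have hre : 0 ≤ (ell τ σ lam ζ).re :=
      (mem_diskZ_iff (ne_zero_of_norm_eq_one hτ) (sum_alpha_pos hτσ hlam) hζ0).mp hζZ
    exact mem_gen_of_isHerglotz_remainder hτ hσ hτσ hlam (isHerglotz_remainder_extremalG hτ hre)
  · rintro G hG rfl hβ
    exact eqOn_extremalG hτ hσ hτσ (hherglotz G hG fun h => hζ0 (h zero_mem_disk)) hβ
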